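/- Let $F$ be a field of characteristic $2$. For a power series $G\in F[[x_1,\dots,x_s]]$ and $n\ge 0$, put $$e_n(G)=\dim_F F[[x_1,\dots,x_s]]/(x_1^{2^n},\dots,x_s^{2^n},G).$$ A Hilbert–Kunz multiplicity (of a hypersurface over $F$) is a real number of the form $\lim_{n\to\infty} e_n(G)/2^{n(s-1)}$, where $s\ge 1$ and $G$ is a nonzero element of the maximal ideal of $F[[x_1,\dots,x_s]]$. Theorem 1.10. Let $f\in F[[x,y,z]]$, let $uv+f$ be the power series in the five variables $x,y,z,u,v$, and write $$\theta_f=(1-16w)\sum_{n\ge 0}e_n(uv+f)\,w^n=\sum_{n\ge 0}a_nw^n\in\mathbb{Z}[[w]].$$ Then the five series $$\sum_{n\ge0}\frac{a_{2n}^2}{2^{16n}},\quad \sum_{n\ge0}\frac{a_{2n+1}^2}{2^{16n}},\quad \sum_{n\ge0}\frac{a_{2n}a_{2n+1}}{2^{16n}},\quad \sum_{n\ge0}\frac{a_{2n+1}a_{2n+2}}{2^{16n}},\quad \sum_{n\ge0}\frac{a_{2n}a_{2n+2}}{2^{16n}}$$ converge, and the sum of each is a $\mathbb{Q}$-linear combination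 of Hilbert–Kunz multiplicities of hypersurfaces over $F$. -/

import Mathlib

/-- For `q = 2 ^ n`, the ideal `(x_i ^ q : i ∈ σ) + (G)` of the power series ring `F[[x_i : i ∈ σ]]`
(for a field `F` of characteristic 2, the first summand is the `n`-th Frobenius power of the
maximal ideal). -/
noncomputable def hkIdeal {F : Type*} [Field F] {σ : Type*} (G : MvPowerSeries σ F) (n : ℕ) :
    Ideal (MvPowerSeries σ F) :=
  Ideal.span (Set.range fun i : σ => (MvPowerSeries.X i : MvPowerSeries σ F) ^ 2 ^ n) ⊔
    Ideal.span {G}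

/-- The Hilbert–Kunz function `n ↦ e_n(G)` in characteristic 2: the (finite, if `σ` is finite)
`F`-dimension of `F[[x_i : i ∈ σ]] / (x_i ^ q, G)`, `q = 2 ^ n`. -/
noncomputable def hilbertKunz {F : Type*} [Field F] {σ : Type*} (G : MvPowerSeries σ F) (n : ℕ) :
    ℕ :=
  Module.finrank F (MvPowerSeries σ F ⧸ hkIdeal G n)

/-- `m` is the Hilbert–Kunz multiplicity of a (characteristic 2) hypersurface over `F`: for some
`d` and some nonzero `G` in the maximal ideal of `F[[x_0, …, x_d]]`, it is the limit of
`e_n(G) / q ^ d`, `q = 2 ^ n`, where `d` is the dimension of `F[[x_0, …, x_d]] / (G)`. -/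
def IsHilbertKunzMultiplicity (F : Type*) [Field F] (m : ℝ) : Prop :=
  ∃ (d : ℕ) (G : MvPowerSeries (Fin (d + 1)) F), G ≠ 0 ∧ MvPowerSeries.constantCoeff G = 0 ∧
    Filter.Tendsto (fun n : ℕ => (hilbertKunz G n : ℝ) / ((2 : ℝ) ^ n) ^ d)
      Filter.atTop (nhds m)

/-- The real numbers that are `ℚ`-linear combinations of Hilbert–Kunz multiplicities of
hypersurfaces over `F`. -/
noncomputable def hkSpan (F : Type*) [Field F] : Submodule ℚ ℝ :=
  Submodule.span ℚ {m : ℝ | IsHilbertKunzMultiplicity F m}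

/-- `G = u v + g`, as a power series in the `r` variables of `g` and two new variables `u, v`. -/
noncomputable def addUV {F : Type*} [Field F] {r : ℕ} (g : MvPowerSeries (Fin r) F) :
    MvPowerSeries (Fin r ⊕ Fin 2) F :=
  MvPowerSeries.X (Sum.inr 0) * MvPowerSeries.X (Sum.inr 1) +
    MvPowerSeries.rename (Sum.inl : Fin r → Fin r ⊕ Fin 2) g

/-- `θ_g = (1 - 2 ^ (r + 1) w) ∑ e_n(uv + g) w ^ n` in `ℤ[[w]]`, for `g` in `r` variables. -/
noncomputable def hkTheta {F : Type*} [Field F] {r : ℕ} (g : MvPowerSeries (Fin r) F) :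
    PowerSeries ℤ :=
  (1 - PowerSeries.C (2 ^ (r + 1)) * PowerSeries.X) *
    PowerSeries.mk fun n => (hilbertKunz (addUV g) n : ℤ)

/-! Suppose that `f`, in `s` variables, has zero constant term (otherwise `uv + f` is a unit and
everything vanishes). Multiplication by `f` modulo the `2 ^ n`-th powers of the variables is a
nilpotent operator, and the coefficient `a_n` turns out to be its number of Jordan blocks of odd
size, `oddCount f n`. Indeed `e_n(f + g)`, for `f` and `g` in disjoint variables, depends only on
the Jordan types of `f` and `g` (`hilbertKunz_add`); those of `uv` are explicit. Frobenius relates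
even powers of `f` at level `n + 1` to powers at level `n` (`powNullity_mulOp_two_mul`), whence
`e_(n+1) = 2 ^ (s + 1) e_n + a_(n+1)` (`hilbertKunz_uvSum_succ`). So the multiplicity of `uv + f` is
the sum of `a_n / 2 ^ ((s + 1) n)` (`exists_hasSum_oddCount`).

In characteristic 2 the number of odd blocks is multiplicative: `a_n(f + g) = a_n(f) a_n(g)` in
disjoint variables (`oddBlocks_tensorAdd`). This reduces to a tensor product of two blocks, where
replacing a block size `i` by `q - i`, with `q` an even power of 2, is a syzygy and preserves the
count (`oddBlocks_syzygy`).

Now take `f(x) + g(y) + t ^ k` in seven variables: the sum of `a_n(f) a_n(g) a_n(t ^ k) / 2 ^ (8 n)`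
is a multiplicity. For `n > 0`, `a_n(t ^ 3)` is constantly 2, while `a_n(t ^ 5)` is 2 or 4 according
to the parity of `n`, so combinations of `k = 3` and `k = 5` isolate either parity. Finally
`a_(n+1)(f ^ 2) = 2 ^ s a_n(f)`, so the choices `g = f, f ^ 2, f ^ 4` shift the index of one factor
by 0, 1, 2 and yield the five series. -/

/-- The dimension of the kernel of the `k`-th power of `T`. -/
noncomputable def powNullity {F V : Type*} [Field F] [AddCommGroup V] [Module F V]
    (T : Module.End F V) (k : ℕ) : ℕ :=
  Module.finrank F (LinearMap.ker (T ^ k))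

/-- If `T ^ N = 0`, this is the number of Jordan blocks of `T` of odd size. -/
noncomputable def oddBlocks {F V : Type*} [Field F] [AddCommGroup V] [Module F V]
    (T : Module.End F V) (N : ℕ) : ℤ :=
  ∑ i ∈ Finset.range N, (-1) ^ i * ((powNullity T (i + 1) : ℤ) - powNullity T i)

/-! ### Kernel dimensions of powers of an operator, and syzygies -/

section powNullity

variable {F V W : Type*} [Field F] [AddCommGroup V] [Module F V] [AddCommGroup W] [Module F W]

theorem powNullity_zero (T : Module.End F V) : powNullity T 0 = 0 := by
  have : LinearMap.ker (1 : Module.End F V) = ⊥ := LinearMap.ker_id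
  rw [powNullity, pow_zero, this, finrank_bot]

theorem powNullity_of_pow_eq_zero (T : Module.End F V) {k : ℕ} (h : T ^ k = 0) :
    powNullity T k = Module.finrank F V := by
  rw [powNullity, h, LinearMap.ker_zero, finrank_top]

theorem powNullity_mono [FiniteDimensional F V] (T : Module.End F V) : Monotone (powNullity T) := by
  intro a b h
  apply Submodule.finrank_mono
  intro v hv
  rw [LinearMap.mem_ker] at hv ⊢
  rw [← Nat.sub_add_cancel h, pow_add, Module.End.mul_apply, hv, map_zero]

theorem powNullity_le [FiniteDimensional F V] (T : Module.End F V) (k : ℕ) :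
    powNullity T k ≤ Module.finrank F V := Submodule.finrank_le _

/-- `T ^ b` maps `ker T ^ (a + b)` into `ker T ^ a`, with kernel inside `ker T ^ b`. -/
theorem powNullity_add_le [FiniteDimensional F V] (T : Module.End F V) (a b : ℕ) :
    powNullity T (a + b) ≤ powNullity T a + powNullity T b := by
  have h := LinearMap.finrank_range_add_finrank_ker
    ((T ^ b).domRestrict (LinearMap.ker (T ^ (a + b))))
  have h1 : Module.finrank F
      (LinearMap.range ((T ^ b).domRestrict (LinearMap.ker (T ^ (a + b))))) ≤ powNullity T a := by
    apply Submodule.finrank_mono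
    rintro _ ⟨⟨v, hv⟩, rfl⟩
    rw [LinearMap.mem_ker, pow_add, Module.End.mul_apply] at hv
    simpa using hv
  have h2 : Module.finrank F
      (LinearMap.ker ((T ^ b).domRestrict (LinearMap.ker (T ^ (a + b))))) ≤ powNullity T b := by
    refine LinearMap.finrank_le_finrank_of_injective
      (f := (((LinearMap.ker (T ^ (a + b))).subtype.comp (Submodule.subtype _)).codRestrict
        (LinearMap.ker (T ^ b)) ?_)) ?_
    · rintro ⟨⟨v, hv⟩, hv'⟩
      simpa using hv'
    · intro x y hxy
      ext
      simpa using congrArg Subtype.val hxy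
  change Module.finrank F (LinearMap.ker (T ^ (a + b))) ≤ _
  omega

theorem pow_intertwine {S : Module.End F V} {T : Module.End F W} (e : V →ₗ[F] W)
    (h : ∀ v, e (S v) = T (e v)) (k : ℕ) (v : V) : e ((S ^ k) v) = (T ^ k) (e v) := by
  induction k generalizing v with
  | zero => simp
  | succ k ih => rw [pow_succ, pow_succ, Module.End.mul_apply, Module.End.mul_apply, ih, h]

theorem powNullity_eq_sum_of_equiv {ι : Type*} [Fintype ι] {M : ι → Type*}
    [∀ i, AddCommGroup (M i)] [∀ i, Module F (M i)] [∀ i, FiniteDimensional F (M i)]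
    {S : Module.End F V} {T : ∀ i, Module.End F (M i)} (e : V ≃ₗ[F] ∀ i, M i)
    (h : ∀ v i, e (S v) i = T i (e v i)) (k : ℕ) :
    powNullity S k = ∑ i, powNullity (T i) k := by
  have hk : ∀ v i, e ((S ^ k) v) i = (T i ^ k) (e v i) := fun v i =>
    pow_intertwine ((LinearMap.proj i).comp e.toLinearMap) (fun v => h v i) k v
  unfold powNullity
  rw [← Module.finrank_pi_fintype F]
  apply LinearEquiv.finrank_eq
  refine LinearEquiv.ofLinearMap
    (LinearMap.pi fun i => ((LinearMap.proj i).comp (e.toLinearMap.comp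
      (Submodule.subtype _))).codRestrict _ ?_)
    ((e.symm.toLinearMap.comp (LinearMap.pi fun i =>
      (Submodule.subtype _).comp (LinearMap.proj i))).codRestrict _ ?_) ?_ ?_
  · rintro ⟨v, hv⟩
    rw [LinearMap.mem_ker] at hv ⊢
    simp [← hk, hv]
  · intro v
    rw [LinearMap.mem_ker]
    apply e.injective
    ext i
    rw [hk]
    simp
  · ext v i; simp
  · ext v
    exact e.symm_apply_apply _

theorem powNullity_eq_of_equiv {S : Module.End F V} {T : Module.End F W} (e : V ≃ₗ[F] W)
    (h : ∀ v, e (S v) = T (e v)) : powNullity S = powNullity T := by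
  ext k
  unfold powNullity
  refine LinearEquiv.finrank_eq (e.submoduleMap _ |>.trans (LinearEquiv.ofEq _ _ ?_))
  ext w
  simp only [Submodule.mem_map, LinearMap.mem_ker]
  constructor
  · rintro ⟨v, hv, rfl⟩
    have := pow_intertwine e.toLinearMap h k v
    simp_all
  · intro hw
    refine ⟨e.symm w, e.injective ?_, by simp⟩
    have := pow_intertwine e.toLinearMap h k (e.symm w)
    simp_all

/-- A nilpotent endomorphism `T` with `T ^ q = 0` whose kernel is as small as its dimension permits
makes `V` a free module over `F[T] / T ^ q`. -/
theorem powNullity_eq_mul [FiniteDimensional F V] {T : Module.End F V} {q r : ℕ} (hq : T ^ q = 0)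
    (hV : Module.finrank F V = q * r) (h1 : powNullity T 1 ≤ r) {k : ℕ} (hk : k ≤ q) :
    powNullity T k = k * r := by
  have hle : ∀ j, powNullity T j ≤ j * r := by
    intro j
    induction j with
    | zero => simp [powNullity_zero]
    | succ j ih => have := powNullity_add_le T j 1; rw [add_mul, one_mul]; omega
  -- Subadditivity at `q = k + (q - k)` squeezes: the two upper bounds `k r` and `(q - k) r` already
  -- add up to `q r`, so both are attained.
  have h2 := powNullity_add_le T k (q - k)
  rw [Nat.add_sub_cancel' hk, powNullity_of_pow_eq_zero T hq, hV] at h2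
  have h3 := hle (q - k)
  have h4 := hle k
  have h5 : q * r = k * r + (q - k) * r := by rw [← add_mul, Nat.add_sub_cancel' hk]
  omega

theorem oddBlocks_eq_sum_of_equiv {ι : Type*} [Fintype ι] {M : ι → Type*}
    [∀ i, AddCommGroup (M i)] [∀ i, Module F (M i)] [∀ i, FiniteDimensional F (M i)]
    {S : Module.End F V} {T : ∀ i, Module.End F (M i)} (e : V ≃ₗ[F] ∀ i, M i)
    (h : ∀ v i, e (S v) i = T i (e v i)) (N : ℕ) :
    oddBlocks S N = ∑ i, oddBlocks (T i) N := by
  simp only [oddBlocks, powNullity_eq_sum_of_equiv e h]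
  rw [Finset.sum_comm]
  push_cast
  simp only [← Finset.sum_sub_distrib, Finset.mul_sum]

theorem oddBlocks_eq_of_equiv {S : Module.End F V} {T : Module.End F W} (e : V ≃ₗ[F] W)
    (h : ∀ v, e (S v) = T (e v)) : oddBlocks S = oddBlocks T := by
  ext N
  simp only [oddBlocks, powNullity_eq_of_equiv e h]

theorem oddBlocks_eq_of_le {T : Module.End F V} {N N' : ℕ} (hN : T ^ N = 0) (h : N ≤ N') :
    oddBlocks T N' = oddBlocks T N := by
  unfold oddBlocks
  rw [← Finset.sum_range_add_sum_Ico _ h, add_eq_left]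
  apply Finset.sum_eq_zero
  intro i hi
  rw [Finset.mem_Ico] at hi
  rw [powNullity_of_pow_eq_zero T (pow_eq_zero_of_le (by omega) hN),
    powNullity_of_pow_eq_zero T (pow_eq_zero_of_le (by omega) hN)]
  simp

theorem abs_oddBlocks_le [FiniteDimensional F V] (T : Module.End F V) (N : ℕ) :
    |oddBlocks T N| ≤ Module.finrank F V := by
  have h1 : |oddBlocks T N| ≤
      ∑ i ∈ Finset.range N, ((powNullity T (i + 1) : ℤ) - powNullity T i) := by
    refine (Finset.abs_sum_le_sum_abs _ _).trans (Finset.sum_le_sum fun i _ => ?_)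
    have := powNullity_mono T (Nat.le_succ i)
    rw [abs_mul, abs_pow, abs_neg, abs_one, one_pow, one_mul, abs_of_nonneg]
    simp only [Nat.succ_eq_add_one] at this
    omega
  rw [Finset.sum_range_sub (fun i => (powNullity T i : ℤ))] at h1
  have := powNullity_le T N
  omega

/-- In a short exact sequence `0 → A → P → B → 0` with `P` free over `F[T] / T ^ q`, the module `A`
is a syzygy of `B`, and the kernels of the powers of `T` on `A` and `B` determine one another. -/
theorem powNullity_syzygy {A P B : Type*} [AddCommGroup A] [Module F A] [AddCommGroup P]
    [Module F P] [AddCommGroup B] [Module F B] [FiniteDimensional F A] [FiniteDimensional F P]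
    [FiniteDimensional F B] {TA : Module.End F A} {TP : Module.End F P} {TB : Module.End F B}
    (α : A →ₗ[F] P) (β : P →ₗ[F] B) (hα : Function.Injective α) (hβ : Function.Surjective β)
    (hαβ : LinearMap.range α = LinearMap.ker β) (hA : ∀ a, α (TA a) = TP (α a))
    (hB : ∀ p, β (TP p) = TB (β p)) {q r : ℕ} (hq : TP ^ q = 0)
    (hP : ∀ k ≤ q, powNullity TP k = k * r) {k : ℕ} (hk : k ≤ q) :
    powNullity TB (q - k) + k * r = Module.finrank F B + powNullity TA k := by
  -- As over a free module, the image of `TP ^ (q - k)` is the whole kernel of `TP ^ k`. Pushed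
  -- forward along `β`, this describes the image of `TB ^ (q - k)`; rank–nullity then gives the
  -- count.
  have hrange : LinearMap.range (TP ^ (q - k)) = LinearMap.ker (TP ^ k) := by
    apply Submodule.eq_of_le_of_finrank_eq
    · rintro _ ⟨v, rfl⟩
      rw [LinearMap.mem_ker, ← Module.End.mul_apply, ← pow_add, Nat.add_sub_cancel' hk, hq,
        LinearMap.zero_apply]
    · have h1 := LinearMap.finrank_range_add_finrank_ker (TP ^ (q - k))
      have h2 := hP (q - k) (by omega)
      have h3 := hP q le_rfl
      rw [powNullity_of_pow_eq_zero TP hq] at h3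
      have h4 := hP k hk
      have h5 : q * r = k * r + (q - k) * r := by rw [← add_mul, Nat.add_sub_cancel' hk]
      unfold powNullity at *
      omega
  have hmap : LinearMap.range (TB ^ (q - k)) =
      LinearMap.range (β.domRestrict (LinearMap.ker (TP ^ k))) := by
    rw [LinearMap.range_domRestrict, ← hrange, ← LinearMap.range_comp]
    ext b
    simp only [LinearMap.mem_range, LinearMap.comp_apply]
    constructor
    · rintro ⟨b, rfl⟩
      obtain ⟨p, rfl⟩ := hβ b
      exact ⟨p, pow_intertwine β hB _ _⟩
    · rintro ⟨p, rfl⟩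
      exact ⟨β p, (pow_intertwine β hB _ _).symm⟩
  have hker : Module.finrank F (LinearMap.ker (β.domRestrict (LinearMap.ker (TP ^ k)))) =
      powNullity TA k := by
    symm
    unfold powNullity
    refine LinearEquiv.finrank_eq (LinearEquiv.ofBijective
      (((α.comp (Submodule.subtype _)).codRestrict (LinearMap.ker (TP ^ k)) ?_).codRestrict
        (LinearMap.ker (β.domRestrict (LinearMap.ker (TP ^ k)))) ?_) ⟨?_, ?_⟩)
    · rintro ⟨a, ha⟩
      rw [LinearMap.mem_ker] at ha ⊢
      simp [← pow_intertwine α hA, ha]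
    · rintro ⟨a, ha⟩
      have : α a ∈ LinearMap.ker β := hαβ ▸ ⟨a, rfl⟩
      simpa using this
    · intro a b hab
      have := congrArg (fun x => (x : LinearMap.ker (TP ^ k)).1) (congrArg Subtype.val hab)
      exact Subtype.ext (hα this)
    · rintro ⟨⟨p, hp⟩, hp'⟩
      have : p ∈ LinearMap.range α := by rw [hαβ]; simpa using hp'
      obtain ⟨a, rfl⟩ := this
      refine ⟨⟨a, ?_⟩, ?_⟩
      · rw [LinearMap.mem_ker] at hp ⊢
        apply hα
        rw [pow_intertwine α hA, hp, map_zero]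
      · rfl
  have h1 := LinearMap.finrank_range_add_finrank_ker (TB ^ (q - k))
  have h2 := LinearMap.finrank_range_add_finrank_ker (β.domRestrict (LinearMap.ker (TP ^ k)))
  rw [hker, ← hmap] at h2
  have h4 := hP k hk
  unfold powNullity at *
  omega

/-- Taking differences in `powNullity_syzygy`, the increment of `TA` at `k` is `r` minus the
increment of `TB` at `q - 1 - k`: apart from blocks of size `q`, blocks of size `b` in `B` match
blocks of size `q - b` in `A`. Parity is preserved because `q` is even. -/
theorem oddBlocks_syzygy {A P B : Type*} [AddCommGroup A] [Module F A] [AddCommGroup P]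
    [Module F P] [AddCommGroup B] [Module F B] [FiniteDimensional F A] [FiniteDimensional F P]
    [FiniteDimensional F B] {TA : Module.End F A} {TP : Module.End F P} {TB : Module.End F B}
    (α : A →ₗ[F] P) (β : P →ₗ[F] B) (hα : Function.Injective α) (hβ : Function.Surjective β)
    (hαβ : LinearMap.range α = LinearMap.ker β) (hA : ∀ a, α (TA a) = TP (α a))
    (hB : ∀ p, β (TP p) = TB (β p)) {q r : ℕ} (hq : TP ^ q = 0) (hq2 : Even q)
    (hP : ∀ k ≤ q, powNullity TP k = k * r) :
    oddBlocks TA q = oddBlocks TB q := by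
  have key := fun k hk => powNullity_syzygy α β hα hβ hαβ hA hB hq hP (k := k) hk
  unfold oddBlocks
  rw [← Finset.sum_range_reflect (fun i => (-1 : ℤ) ^ i *
    ((powNullity TB (i + 1) : ℤ) - powNullity TB i))]
  -- The constant `r` cancels from an alternating sum of even length.
  have h0 : ∑ k ∈ Finset.range q, (-1 : ℤ) ^ k * (r : ℤ) = 0 := by
    rw [← Finset.sum_mul]
    rw [neg_one_geom_sum, if_pos hq2, zero_mul]
  rw [← sub_eq_zero, ← Finset.sum_sub_distrib, ← h0]
  apply Finset.sum_congr rfl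
  intro k hk
  rw [Finset.mem_range] at hk
  have h1 := key k hk.le
  have h2 := key (k + 1) hk
  have hs : (-1 : ℤ) ^ (q - 1 - k) = - (-1) ^ k := by
    have h3 : (-1 : ℤ) ^ (q - 1 - k) * (-1) ^ (k + 1) = 1 := by
      rw [← pow_add, show q - 1 - k + (k + 1) = q by omega, hq2.neg_one_pow]
    have h4 : (-1 : ℤ) ^ k * (-1) ^ k = 1 := by
      rw [← pow_add, Even.neg_one_pow ⟨k, rfl⟩]
    rw [pow_succ] at h3
    calc (-1 : ℤ) ^ (q - 1 - k) = (-1 : ℤ) ^ (q - 1 - k) * ((-1 : ℤ) ^ k * (-1) ^ k) := by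
          rw [h4, mul_one]
      _ = - ((-1 : ℤ) ^ (q - 1 - k) * ((-1) ^ k * -1)) * (-1) ^ k := by ring
      _ = _ := by rw [h3]; ring
  rw [hs, show q - 1 - k + 1 = q - k by omega, show q - 1 - k = q - (k + 1) by omega]
  zify at h1 h2
  linear_combination (-1 : ℤ) ^ k * (h1 - h2)

end powNullity

/-! ### Tensoring an operator with one Jordan block -/

/-- The endomorphism `x ⊗ 1 + 1 ⊗ T` of `F[x] / x ^ m ⊗ W`, with `F[x] / x ^ m ⊗ W` identified with
the sequences of `m` elements of `W`. -/
noncomputable def blockAdd {F W : Type*} [Field F] [AddCommGroup W] [Module F W] (m : ℕ)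
    (T : Module.End F W) : Module.End F (Fin m → W) :=
  LinearMap.pi fun k => T.comp (LinearMap.proj k) +
    if h : 0 < (k : ℕ) then LinearMap.proj ⟨k - 1, by omega⟩ else 0

section blockAdd

variable {F V W : Type*} [Field F] [AddCommGroup V] [Module F V] [AddCommGroup W] [Module F W]

theorem blockAdd_apply (m : ℕ) (T : Module.End F W) (w : Fin m → W) (k : Fin m) :
    blockAdd m T w k = T (w k) + if h : 0 < (k : ℕ) then w ⟨k - 1, by omega⟩ else 0 := by
  simp only [blockAdd, LinearMap.pi_apply, LinearMap.add_apply, LinearMap.comp_apply,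
    LinearMap.proj_apply]
  split_ifs <;> simp

/-- An element of the kernel of `x ⊗ 1 + 1 ⊗ T` is determined by its top coordinate, which can be
any element of the kernel of `T ^ m`. -/
theorem powNullity_blockAdd_one (m : ℕ) (T : Module.End F W) :
    powNullity (blockAdd m T) 1 = powNullity T m := by
  obtain _ | m := m
  · rw [powNullity_zero, powNullity]
    exact Module.finrank_zero_of_subsingleton
  -- Coordinate `k > 0` of the kernel equation says `w (k - 1) = -T (w k)`; coordinate `0` then
  -- imposes `(-T) ^ (m + 1) = 0` on the top entry.
  have key : ∀ w : Fin (m + 1) → W, blockAdd (m + 1) T w = 0 →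
      ∀ j (hj : j ≤ m), w ⟨m - j, by omega⟩ = ((-T) ^ j) (w (Fin.last m)) := by
    intro w hw j
    induction j with
    | zero => intro _; rfl
    | succ j ih =>
      intro hj
      have h1 := congrFun hw ⟨m - j, by omega⟩
      rw [blockAdd_apply, dif_pos (by simp; omega), ih (by omega)] at h1
      rw [pow_succ', Module.End.mul_apply, LinearMap.neg_apply, ← eq_neg_of_add_eq_zero_right h1]
      simp only [Nat.sub_sub]
  have hneg : ∀ w : W, ((-T) ^ (m + 1)) w = 0 ↔ (T ^ (m + 1)) w = 0 := by
    intro w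
    rcases Nat.even_or_odd (m + 1) with h | h
    · rw [h.neg_pow]
    · rw [h.neg_pow, LinearMap.neg_apply, neg_eq_zero]
  unfold powNullity
  rw [pow_one]
  refine LinearEquiv.finrank_eq (LinearEquiv.ofBijective
    (((LinearMap.proj (Fin.last m)).comp (Submodule.subtype _)).codRestrict _ ?_) ⟨?_, ?_⟩)
  · rintro ⟨w, hw⟩
    rw [LinearMap.mem_ker] at hw ⊢
    have h0 := key w hw m le_rfl
    have h1 := congrFun hw ⟨0, by omega⟩
    rw [blockAdd_apply, dif_neg (by simp), add_zero] at h1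
    simp only [Nat.sub_self] at h0
    rw [h0] at h1
    rw [← hneg, pow_succ', Module.End.mul_apply, LinearMap.neg_apply]
    simpa using h1
  · rw [← LinearMap.ker_eq_bot, LinearMap.ker_eq_bot']
    rintro ⟨w, hw⟩ h
    have h' : w (Fin.last m) = 0 := congrArg Subtype.val h
    ext k
    have := key w hw (m - k) (by omega)
    rw [h', map_zero] at this
    simpa [Nat.sub_sub_self (Nat.lt_succ_iff.mp k.2)] using this
  · rintro ⟨u, hu⟩
    rw [LinearMap.mem_ker] at hu
    refine ⟨⟨fun k => ((-T) ^ (m - k)) u, ?_⟩, Subtype.ext (by simp)⟩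
    rw [LinearMap.mem_ker]
    ext k
    rw [blockAdd_apply, Pi.zero_apply]
    split_ifs with h
    · simp only
      rw [show m - (k - 1 : ℕ) = m - k + 1 by omega, pow_succ', Module.End.mul_apply]
      simp
    · have hk : m - (k : ℕ) = m := by omega
      simp only [hk, add_zero]
      have := (hneg u).2 hu
      rw [pow_succ', Module.End.mul_apply, LinearMap.neg_apply, neg_eq_zero] at this
      exact this

theorem blockAdd_eq_add (m : ℕ) (T : Module.End F W) :
    blockAdd m T = blockAdd m (0 : Module.End F W) + T.compLeft (Fin m) := by
  ext1 w
  ext k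
  simp [blockAdd_apply, add_comm]

theorem blockAdd_zero_pow_apply (m : ℕ) (j : ℕ) (w : Fin m → W) (k : Fin m) :
    (blockAdd m (0 : Module.End F W) ^ j) w k =
      if h : j ≤ (k : ℕ) then w ⟨k - j, by omega⟩ else 0 := by
  induction j generalizing w k with
  | zero => simp
  | succ j ih =>
    rw [pow_succ', Module.End.mul_apply, blockAdd_apply, LinearMap.zero_apply, zero_add]
    by_cases h : 0 < (k : ℕ)
    · rw [dif_pos h, ih]
      by_cases h' : j + 1 ≤ (k : ℕ)
      · rw [dif_pos h', dif_pos (by simp only; omega)]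
        simp [Nat.sub_sub, add_comm]
      · rw [dif_neg h', dif_neg (by simp only; omega)]
    · rw [dif_neg h, dif_neg (by omega)]

theorem blockAdd_zero_pow_self (m : ℕ) : blockAdd m (0 : Module.End F W) ^ m = 0 := by
  refine LinearMap.ext fun w => funext fun k => ?_
  rw [blockAdd_zero_pow_apply, dif_neg (by omega)]
  rfl

theorem commute_blockAdd_zero (m : ℕ) (T : Module.End F W) :
    Commute (blockAdd m (0 : Module.End F W)) (T.compLeft (Fin m)) := by
  refine LinearMap.ext fun w => funext fun k => ?_
  rw [Module.End.mul_apply, Module.End.mul_apply, blockAdd_apply, LinearMap.compLeft_apply,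
    LinearMap.compLeft_apply, Function.comp_apply, Function.comp_apply, blockAdd_apply]
  split_ifs <;> simp

theorem compLeft_pow (m j : ℕ) (T : Module.End F W) :
    T.compLeft (Fin m) ^ j = (T ^ j).compLeft (Fin m) := by
  induction j with
  | zero => rfl
  | succ j ih => rw [pow_succ, ih, pow_succ]; rfl

theorem add_pow_two_pow [CharP F 2] {S T : Module.End F V} (h : Commute S T) (n : ℕ) :
    (S + T) ^ 2 ^ n = S ^ 2 ^ n + T ^ 2 ^ n := by
  induction n with
  | zero => simp
  | succ n ih =>
    have h2 : ∀ A : Module.End F V, A + A = 0 := fun A => by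
      rw [← two_smul F A, CharTwo.two_eq_zero, zero_smul]
    have hc : Commute (S ^ 2 ^ n) (T ^ 2 ^ n) := h.pow_pow _ _
    rw [pow_succ, pow_mul, ih, pow_mul, pow_mul, pow_two, add_mul, mul_add, mul_add, ← hc.eq,
      pow_two, pow_two]
    have := h2 (S ^ 2 ^ n * T ^ 2 ^ n)
    calc _ = S ^ 2 ^ n * S ^ 2 ^ n + (S ^ 2 ^ n * T ^ 2 ^ n + S ^ 2 ^ n * T ^ 2 ^ n)
          + T ^ 2 ^ n * T ^ 2 ^ n := by abel
      _ = _ := by rw [this, add_zero]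

theorem blockAdd_pow_eq_zero [CharP F 2] {m n : ℕ} (hm : m ≤ 2 ^ n) {T : Module.End F W}
    (hT : T ^ 2 ^ n = 0) : blockAdd m T ^ 2 ^ n = 0 := by
  rw [blockAdd_eq_add, add_pow_two_pow (commute_blockAdd_zero m T), compLeft_pow, hT,
    pow_eq_zero_of_le hm (blockAdd_zero_pow_self m), zero_add]
  ext1 w
  ext k
  simp

/-- Freeness of `F[x] / x ^ q ⊗ W` for `q = 2 ^ n`: in characteristic 2 the operator `x ⊗ 1 + 1 ⊗ T`
still has `q`-th power zero, and its kernel has dimension `dim W`, the least possible. -/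
theorem powNullity_blockAdd_of_le [CharP F 2] [FiniteDimensional F W] {n : ℕ} {T : Module.End F W}
    (hT : T ^ 2 ^ n = 0) {k : ℕ} (hk : k ≤ 2 ^ n) :
    powNullity (blockAdd (2 ^ n) T) k = k * Module.finrank F W :=
  powNullity_eq_mul (blockAdd_pow_eq_zero le_rfl hT) (by simp [Module.finrank_pi_fintype])
    (by rw [powNullity_blockAdd_one, powNullity_of_pow_eq_zero T hT]) hk

theorem powNullity_blockAdd_zero (m k : ℕ) :
    powNullity (blockAdd m (0 : Module.End F F)) k = min k m := by
  rcases le_total k m with h | h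
  · rw [min_eq_left h, powNullity_eq_mul (blockAdd_zero_pow_self m) (r := 1) (by simp) _ h, mul_one]
    rw [powNullity_blockAdd_one]
    simpa using powNullity_le (0 : Module.End F F) m
  · rw [min_eq_right h, powNullity_of_pow_eq_zero _ (pow_eq_zero_of_le h (blockAdd_zero_pow_self m))]
    simp

/-- The sequence `0 → F[x] / x ^ (q - i) → F[x] / x ^ q → F[x] / x ^ i → 0`, tensored with `W`, has
free middle term, so `oddBlocks_syzygy` applies. -/
theorem oddBlocks_blockAdd_sub [CharP F 2] [FiniteDimensional F W] {n i : ℕ} (hi : i ≤ 2 ^ (n + 1))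
    {T : Module.End F W} (hT : T ^ 2 ^ (n + 1) = 0) :
    oddBlocks (blockAdd (2 ^ (n + 1) - i) T) (2 ^ (n + 1)) =
      oddBlocks (blockAdd i T) (2 ^ (n + 1)) := by
  let q := 2 ^ (n + 1)
  -- `α` is multiplication by `x ^ i` and `β` is reduction modulo `x ^ i`.
  let α : (Fin (q - i) → W) →ₗ[F] (Fin q → W) := LinearMap.pi fun k =>
    if h : i ≤ (k : ℕ) then LinearMap.proj ⟨k - i, by omega⟩ else 0
  let β : (Fin q → W) →ₗ[F] (Fin i → W) := LinearMap.funLeft F W (Fin.castLE hi)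
  have hα : ∀ w k, α w k = if h : i ≤ (k : ℕ) then w ⟨k - i, by omega⟩ else 0 := by
    intro w k
    simp only [α, LinearMap.pi_apply]
    split_ifs <;> simp
  have hβ : ∀ w k, β w k = w (Fin.castLE hi k) := fun w k => rfl
  refine oddBlocks_syzygy (TP := blockAdd q T) α β ?_ ?_ ?_ ?_ ?_ (blockAdd_pow_eq_zero le_rfl hT)
    ⟨2 ^ n, by ring⟩ (r := Module.finrank F W) fun k hk => powNullity_blockAdd_of_le hT hk
  · intro v w h
    ext k
    have := congrFun h ⟨k + i, by omega⟩
    simpa [hα] using this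
  · intro w
    refine ⟨fun k => if h : (k : ℕ) < i then w ⟨k, h⟩ else 0, ?_⟩
    ext k
    simp [hβ]
  · ext w
    rw [LinearMap.mem_range, LinearMap.mem_ker]
    constructor
    · rintro ⟨v, rfl⟩
      ext k
      rw [hβ, hα, dif_neg (by simp)]
      rfl
    · intro h
      refine ⟨fun k => w ⟨k + i, by omega⟩, ?_⟩
      ext k
      rw [hα]
      split_ifs with hk
      · simp [Nat.sub_add_cancel hk]
      · exact (congrFun h ⟨k, by omega⟩).symm
  · intro w
    ext k
    simp only [hα, blockAdd_apply]
    by_cases h : i < (k : ℕ)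
    · rw [dif_pos h.le, dif_pos (show 0 < (k : ℕ) - i by omega),
        dif_pos (show 0 < (k : ℕ) by omega), dif_pos (show i ≤ (k : ℕ) - 1 by omega)]
      simp [Nat.sub_right_comm, h.le]
    · by_cases h' : i = (k : ℕ)
      · rw [dif_pos h'.le, dif_neg (by omega), dif_pos h'.le]
        congr 1
        split_ifs
        · omega
        · rfl
        · rfl
      · rw [dif_neg (by omega), dif_neg (by omega)]
        split_ifs
        · omega
        · simp
        · simp
  · intro w
    ext k
    simp only [hβ, blockAdd_apply]
    rfl

theorem oddBlocks_blockAdd_blockAdd_swap (i j N : ℕ) :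
    oddBlocks (blockAdd i (blockAdd j (0 : Module.End F F))) N =
      oddBlocks (blockAdd j (blockAdd i (0 : Module.End F F))) N := by
  refine congrFun (oddBlocks_eq_of_equiv ({
    toFun := fun w b a => w a b
    invFun := fun w a b => w b a
    map_add' := fun _ _ => rfl
    map_smul' := fun _ _ => rfl
    left_inv := fun _ => rfl
    right_inv := fun _ => rfl } : (Fin i → Fin j → F) ≃ₗ[F] (Fin j → Fin i → F)) fun w => ?_) N
  ext b a
  change blockAdd i (blockAdd j (0 : Module.End F F)) w a b = _
  rw [blockAdd_apply, Pi.add_apply, blockAdd_apply, blockAdd_apply, Pi.add_apply, blockAdd_apply,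
    LinearMap.zero_apply, LinearMap.zero_apply, zero_add, zero_add, add_comm]
  congr 1 <;> split_ifs <;> rfl

/-- Induction on `n`: a size above `2 ^ n` is replaced by its complement in `2 ^ (n + 1)`, which has
the same parity and is at most `2 ^ n`. The two sizes are treated in turn by symmetry, down to sizes
0 and 1. -/
theorem oddBlocks_blockAdd_blockAdd [CharP F 2] (n : ℕ) : ∀ {i j : ℕ}, i ≤ 2 ^ n → j ≤ 2 ^ n →
    oddBlocks (blockAdd i (blockAdd j (0 : Module.End F F))) (2 ^ n) =
      if Odd i ∧ Odd j then 1 else 0 := by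
  induction n with
  | zero =>
    intro i j hi hj
    simp only [oddBlocks, pow_zero, Finset.sum_range_one, zero_add, powNullity_zero,
      powNullity_blockAdd_one, powNullity_blockAdd_zero]
    have hi' : i = 0 ∨ i = 1 := by omega
    have hj' : j = 0 ∨ j = 1 := by omega
    rcases hi' with rfl | rfl <;> rcases hj' with rfl | rfl <;> simp
  | succ n ih =>
    have hq : (2 : ℕ) ^ (n + 1) = 2 ^ n + 2 ^ n := by ring
    have hpar : ∀ i ≤ 2 ^ (n + 1), (Odd (2 ^ (n + 1) - i) ↔ Odd i) := by
      intro i hi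
      rw [hq] at hi ⊢
      rw [Nat.odd_iff, Nat.odd_iff]
      omega
    have hnil : ∀ {j}, j ≤ 2 ^ (n + 1) → blockAdd j (0 : Module.End F F) ^ 2 ^ (n + 1) = 0 :=
      fun hj => pow_eq_zero_of_le hj (blockAdd_zero_pow_self _)
    have h1 : ∀ {i j}, i ≤ 2 ^ n → j ≤ 2 ^ n →
        oddBlocks (blockAdd i (blockAdd j (0 : Module.End F F))) (2 ^ (n + 1)) =
          if Odd i ∧ Odd j then 1 else 0 := by
      intro i j hi hj
      rw [← ih hi hj]
      exact oddBlocks_eq_of_le (blockAdd_pow_eq_zero hi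
        (pow_eq_zero_of_le hj (blockAdd_zero_pow_self _))) (by omega)
    have h2 : ∀ {i j}, i ≤ 2 ^ (n + 1) → j ≤ 2 ^ n →
        oddBlocks (blockAdd i (blockAdd j (0 : Module.End F F))) (2 ^ (n + 1)) =
          if Odd i ∧ Odd j then 1 else 0 := by
      intro i j hi hj
      rcases le_total i (2 ^ n) with h | h
      · exact h1 h hj
      · rw [← oddBlocks_blockAdd_sub hi (hnil (by omega)), h1 (by omega) hj]
        simp only [hpar i hi]
    intro i j hi hj
    rcases le_total j (2 ^ n) with h | h
    · exact h2 hi h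
    · rw [oddBlocks_blockAdd_blockAdd_swap, ← oddBlocks_blockAdd_sub hj (hnil hi),
        oddBlocks_blockAdd_blockAdd_swap, h2 hi (by omega)]
      simp only [hpar j hj]

theorem oddBlocks_blockAdd_zero {m N : ℕ} (h : m ≤ N) :
    oddBlocks (blockAdd m (0 : Module.End F F)) N = if Odd m then 1 else 0 := by
  rw [oddBlocks_eq_of_le (blockAdd_zero_pow_self m) h]
  have : oddBlocks (blockAdd m (0 : Module.End F F)) m = ∑ i ∈ Finset.range m, (-1 : ℤ) ^ i := by
    apply Finset.sum_congr rfl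
    intro i hi
    rw [Finset.mem_range] at hi
    rw [powNullity_blockAdd_zero, powNullity_blockAdd_zero, min_eq_left hi.le, min_eq_left hi]
    simp
  simp only [this, neg_one_geom_sum, ← Nat.not_even_iff_odd, ite_not]

end blockAdd

/-! ### Jordan decomposition and tensor products -/

open TensorProduct in
/-- The endomorphism `S ⊗ 1 + 1 ⊗ T` of `V ⊗ W`. -/
noncomputable def tensorAdd {F V W : Type*} [Field F] [AddCommGroup V] [Module F V]
    [AddCommGroup W] [Module F W] (S : Module.End F V) (T : Module.End F W) :
    Module.End F (V ⊗[F] W) :=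
  LinearMap.rTensor W S + LinearMap.lTensor V T

section Jordan

variable {F V W : Type*} [Field F] [AddCommGroup V] [Module F V] [AddCommGroup W] [Module F W]

open Polynomial in
/-- The coefficients of a polynomial modulo `X ^ k`. -/
noncomputable def quotXPowEquiv (F : Type*) [Field F] (k : ℕ) :
    (F[X] ⧸ Submodule.span F[X] {(X : F[X]) ^ k}) ≃ₗ[F] (Fin k → F) :=
  (Submodule.Quotient.restrictScalarsEquiv F (Submodule.span F[X] {(X : F[X]) ^ k})).symm ≪≫ₗ
    Submodule.quotEquivOfEq _ (LinearMap.ker (LinearMap.pi fun i : Fin k => lcoeff F i)) (by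
      ext p
      rw [Submodule.restrictScalars_mem, Submodule.mem_span_singleton, LinearMap.mem_ker]
      simp only [smul_eq_mul]
      rw [show (∃ a, a * X ^ k = p) ↔ (X : F[X]) ^ k ∣ p from
        ⟨fun ⟨a, h⟩ => ⟨a, by rw [← h, mul_comm]⟩, fun ⟨a, h⟩ => ⟨a, by rw [h, mul_comm]⟩⟩,
        X_pow_dvd_iff]
      constructor
      · intro h
        ext i
        exact h i i.2
      · intro h i hi
        exact congrFun h ⟨i, hi⟩) ≪≫ₗ
    LinearMap.quotKerEquivOfSurjective (LinearMap.pi fun i : Fin k => lcoeff F i) (by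
      intro v
      refine ⟨∑ i : Fin k, monomial i (v i), ?_⟩
      ext i
      simp [coeff_monomial, Fin.val_inj])

open Polynomial in
theorem quotXPowEquiv_mk (k : ℕ) (p : F[X]) (i : Fin k) :
    quotXPowEquiv F k (Submodule.Quotient.mk p) i = p.coeff i := rfl

open Polynomial in
theorem quotXPowEquiv_X_smul (k : ℕ) (x : F[X] ⧸ Submodule.span F[X] {(X : F[X]) ^ k}) :
    quotXPowEquiv F k ((X : F[X]) • x) = blockAdd k (0 : Module.End F F) (quotXPowEquiv F k x) := by
  obtain ⟨p, rfl⟩ := Submodule.Quotient.mk_surjective _ x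
  ext i
  rw [← Submodule.Quotient.mk_smul, quotXPowEquiv_mk, blockAdd_apply, LinearMap.zero_apply,
    zero_add, smul_eq_mul]
  split_ifs with h
  · rw [quotXPowEquiv_mk]
    obtain ⟨j, hj⟩ : ∃ j, (i : ℕ) = j + 1 := ⟨i - 1, by omega⟩
    simp only [hj, coeff_X_mul, Nat.add_sub_cancel]
  · rw [show (i : ℕ) = 0 by omega, coeff_X_mul_zero]

open Polynomial in
/-- The Jordan normal form of a nilpotent endomorphism. -/
theorem exists_equiv_blockAdd [FiniteDimensional F V] {T : Module.End F V} {N : ℕ}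
    (hT : T ^ N = 0) : ∃ (d : ℕ) (m : Fin d → ℕ) (e : V ≃ₗ[F] ∀ i, (Fin (m i) → F)),
      ∀ v i, e (T v) i = blockAdd (m i) (0 : Module.End F F) (e v i) := by
  classical
  have htors : Module.IsTorsion' (Module.AEval' T) (Submonoid.powers (X : F[X])) := by
    rw [Submodule.isTorsion'_powers_iff]
    intro x
    obtain ⟨v, rfl⟩ := (Module.AEval'.of T).surjective x
    exact ⟨N, by rw [Module.AEval'.X_pow_smul_of, hT, zero_smul, map_zero]⟩
  obtain ⟨d, m, ⟨e⟩⟩ := Module.torsion_by_prime_power_decomposition irreducible_X htors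
  refine ⟨d, m, Module.AEval'.of T ≪≫ₗ e.restrictScalars F ≪≫ₗ
    (DirectSum.linearEquivFunOnFintype F (Fin d)
      (fun i => F[X] ⧸ Submodule.span F[X] {(X : F[X]) ^ m i})) ≪≫ₗ
    LinearEquiv.piCongrRight fun i => quotXPowEquiv F (m i), fun v i => ?_⟩
  simp only [LinearEquiv.trans_apply, LinearEquiv.restrictScalars_apply,
    LinearEquiv.piCongrRight_apply]
  rw [← Module.AEval'.X_smul_of, map_smul, ← quotXPowEquiv_X_smul]
  rfl

open TensorProduct in
theorem exists_equiv_blockAdd_tensorAdd {S : Module.End F V} {d : ℕ} {m : Fin d → ℕ}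
    (e : V ≃ₗ[F] ∀ i, (Fin (m i) → F)) (he : ∀ v i, e (S v) i = blockAdd (m i) (0 : Module.End F F) (e v i))
    (T : Module.End F W) : ∃ e' : V ⊗[F] W ≃ₗ[F] ∀ i, (Fin (m i) → W),
      ∀ x i, e' (tensorAdd S T x) i = blockAdd (m i) T (e' x i) := by
  let e' : V ⊗[F] W ≃ₗ[F] ∀ i, (Fin (m i) → W) :=
    TensorProduct.congr e (LinearEquiv.refl F W) ≪≫ₗ TensorProduct.piLeft F W _ ≪≫ₗ
      LinearEquiv.piCongrRight fun i =>
        TensorProduct.comm F _ _ ≪≫ₗ TensorProduct.piScalarRight F F W (Fin (m i))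
  have he' : ∀ v w i k, e' (v ⊗ₜ w) i k = e v i k • w := by
    intro v w i k
    simp [e']
  refine ⟨e', fun x i => ?_⟩
  induction x with
  | zero => simp
  | add x y hx hy => rw [map_add, map_add, map_add, Pi.add_apply, Pi.add_apply, map_add, hx, hy]
  | tmul v w =>
    ext k
    rw [tensorAdd, LinearMap.add_apply, LinearMap.rTensor_tmul, LinearMap.lTensor_tmul, map_add,
      Pi.add_apply, Pi.add_apply, he', he', he, blockAdd_apply, blockAdd_apply, he', map_smul,
      LinearMap.zero_apply, zero_add, add_comm]
    congr 1
    split_ifs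
    · rw [he']
    · rw [zero_smul]

theorem sum_eq_finrank {d : ℕ} {m : Fin d → ℕ} (e : V ≃ₗ[F] ∀ i, (Fin (m i) → F)) :
    Module.finrank F V = ∑ i, m i := by
  rw [e.finrank_eq]
  simp [Module.finrank_pi_fintype]

/-- At the power `N` the kernel is everything, so in the sum of the `min N (m i)` no term can fall
short of `m i`. -/
theorem block_size_le {S : Module.End F V} {N d : ℕ} {m : Fin d → ℕ}
    (e : V ≃ₗ[F] ∀ i, (Fin (m i) → F)) (he : ∀ v i, e (S v) i = blockAdd (m i) (0 : Module.End F F) (e v i))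
    (hS : S ^ N = 0) (i : Fin d) : m i ≤ N := by
  have h := powNullity_eq_sum_of_equiv e he N
  rw [powNullity_of_pow_eq_zero S hS, sum_eq_finrank e] at h
  simp only [powNullity_blockAdd_zero] at h
  have := (Finset.sum_eq_sum_iff_of_le (fun i _ => min_le_right N (m i))).1 h.symm i
    (Finset.mem_univ i)
  omega

/-- A block of size `m` of `S` contributes `powNullity T m`, the sum of the first `m` increments of
`T`; the increment of `S` at `i` counts the blocks of size larger than `i`. -/
theorem powNullity_tensorAdd_one [FiniteDimensional F V] [FiniteDimensional F W]
    {S : Module.End F V} {N : ℕ} (hS : S ^ N = 0) (T : Module.End F W) :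
    (powNullity (tensorAdd S T) 1 : ℤ) = ∑ i ∈ Finset.range N,
      ((powNullity S (i + 1) : ℤ) - powNullity S i) *
        ((powNullity T (i + 1) : ℤ) - powNullity T i) := by
  obtain ⟨d, m, e, he⟩ := exists_equiv_blockAdd hS
  obtain ⟨e', he'⟩ := exists_equiv_blockAdd_tensorAdd e he T
  have hm := block_size_le e he hS
  simp only [powNullity_eq_sum_of_equiv e he, powNullity_eq_sum_of_equiv e' he',
    powNullity_blockAdd_zero, powNullity_blockAdd_one]
  push_cast
  simp only [← Finset.sum_sub_distrib, Finset.sum_mul]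
  rw [Finset.sum_comm]
  apply Finset.sum_congr rfl
  intro j _
  rw [← Finset.sum_range_add_sum_Ico _ (hm j), Finset.sum_eq_zero (s := Finset.Ico _ _), add_zero]
  · rw [Finset.sum_congr rfl (g := fun i => (powNullity T (i + 1) : ℤ) - powNullity T i),
      Finset.sum_range_sub (fun i => (powNullity T i : ℤ)), powNullity_zero]
    · simp
    · intro i hi
      rw [Finset.mem_range] at hi
      rw [min_eq_left (by omega), min_eq_left (by omega)]
      ring
  · intro i hi
    rw [Finset.mem_Ico] at hi
    rw [min_eq_right (by omega), min_eq_right (by omega), sub_self, zero_mul]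

theorem oddBlocks_eq_sum [FiniteDimensional F V] {S : Module.End F V} {N d : ℕ} {m : Fin d → ℕ}
    (e : V ≃ₗ[F] ∀ i, (Fin (m i) → F)) (he : ∀ v i, e (S v) i = blockAdd (m i) (0 : Module.End F F) (e v i))
    (hS : S ^ N = 0) : oddBlocks S N = ∑ i, if Odd (m i) then 1 else 0 := by
  rw [oddBlocks_eq_sum_of_equiv e he]
  exact Finset.sum_congr rfl fun i _ => oddBlocks_blockAdd_zero (block_size_le e he hS i)

/-- In characteristic 2, the number of Jordan blocks of odd size is multiplicative. -/
theorem oddBlocks_tensorAdd [CharP F 2] [FiniteDimensional F V] [FiniteDimensional F W]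
    {S : Module.End F V} {T : Module.End F W} {n : ℕ} (hS : S ^ 2 ^ n = 0) (hT : T ^ 2 ^ n = 0) :
    oddBlocks (tensorAdd S T) (2 ^ n) = oddBlocks S (2 ^ n) * oddBlocks T (2 ^ n) := by
  obtain ⟨d, m, e, he⟩ := exists_equiv_blockAdd hS
  obtain ⟨d', m', f, hf⟩ := exists_equiv_blockAdd hT
  obtain ⟨e', he'⟩ := exists_equiv_blockAdd_tensorAdd e he T
  rw [oddBlocks_eq_sum_of_equiv e' he', oddBlocks_eq_sum e he hS, oddBlocks_eq_sum f hf hT,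
    Finset.sum_mul_sum]
  apply Finset.sum_congr rfl
  intro i _
  -- Splitting `T` as well leaves only products of two Jordan blocks.
  have key : oddBlocks (blockAdd (m i) T) (2 ^ n) =
      ∑ j, oddBlocks (blockAdd (m i) (blockAdd (m' j) (0 : Module.End F F))) (2 ^ n) := by
    refine oddBlocks_eq_sum_of_equiv ({
      toFun := fun w j a => f (w a) j
      invFun := fun w a => f.symm fun j => w j a
      map_add' := fun _ _ => by ext; simp
      map_smul' := fun _ _ => by ext; simp
      left_inv := fun _ => by ext; simp
      right_inv := fun _ => by ext; simp } :
        (Fin (m i) → W) ≃ₗ[F] ∀ j, (Fin (m i) → Fin (m' j) → F)) (fun w j => ?_) (2 ^ n)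
    ext1 a
    change f (blockAdd (m i) T w a) j = _
    rw [blockAdd_apply, blockAdd_apply, map_add, Pi.add_apply, hf]
    congr 1
    split_ifs
    · rfl
    · simp
  rw [key]
  apply Finset.sum_congr rfl
  intro j _
  rw [oddBlocks_blockAdd_blockAdd n (block_size_le e he hS i) (block_size_le f hf hT j)]
  split_ifs <;> simp_all

end Jordan

/-! ### Quotients by monomial ideals -/

section MonomialIdeal

open MvPowerSeries

variable {F σ ι κ : Type*} [Field F]

/-- Membership in an ideal of power series that is generated by finitely many monomials. -/
theorem mem_span_range_monomial_iff [Finite ι] (s : ι → σ →₀ ℕ) (g : MvPowerSeries σ F) :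
    g ∈ Ideal.span (Set.range fun i => (monomial (s i) (1 : F) : MvPowerSeries σ F)) ↔
      ∀ e, (∀ i, ¬ s i ≤ e) → coeff e g = 0 := by
  classical
  have := Fintype.ofFinite ι
  constructor
  · intro hg e he
    induction hg using Submodule.span_induction generalizing e with
    | mem x hx =>
      obtain ⟨i, rfl⟩ := hx
      exact coeff_monomial_ne (fun h => he i h.ge) 1
    | zero => simp
    | add x y _ _ hx hy => rw [map_add, hx e he, hy e he, add_zero]
    | smul a x _ hx =>
      rw [smul_eq_mul, coeff_mul]
      apply Finset.sum_eq_zero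
      intro p hp
      rw [Finset.HasAntidiagonal.mem_antidiagonal] at hp
      rw [hx p.2 fun i hi => he i (hi.trans (hp ▸ le_add_self)), mul_zero]
  · intro h
    -- Each exponent above some generator is assigned to one chosen generator, so that no
    -- coefficient of `g` is counted twice.
    let piece : ι → MvPowerSeries σ F := fun i e =>
      if hi : ∃ j, s j ≤ s i + e then (if hi.choose = i then coeff (s i + e) g else 0) else 0
    have hpiece : ∀ i e, coeff e (piece i) =
      if hi : ∃ j, s j ≤ s i + e then (if hi.choose = i then coeff (s i + e) g else 0) else 0 :=
        fun i e => rfl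
    have hg : g = ∑ i, piece i * monomial (s i) 1 := by
      ext e
      rw [map_sum]
      simp only [coeff_mul_monomial, mul_one, hpiece]
      by_cases he : ∃ j, s j ≤ e
      · rw [Finset.sum_eq_single he.choose]
        · have h1 := he.choose_spec
          rw [if_pos h1]
          simp only [add_tsub_cancel_of_le h1]
          rw [dif_pos he, if_pos trivial]
        · intro i _ hi
          by_cases h1 : s i ≤ e
          · simp only [add_tsub_cancel_of_le h1]
            rw [if_pos h1, dif_pos he, if_neg hi.symm]
          · rw [if_neg h1]
        · simp
      · push Not at he
        rw [h e he]
        symm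
        exact Finset.sum_eq_zero fun i _ => if_neg (he i)
    rw [hg]
    exact Ideal.sum_mem _ fun i _ => Ideal.mul_mem_left _ _ (Ideal.subset_span ⟨i, rfl⟩)

/-- The quotient by an ideal generated by finitely many monomials has the other monomials as
a basis, if there are finitely many of these. -/
theorem exists_quotient_monomial_equiv [Finite ι] [Finite κ] (s : ι → σ →₀ ℕ)
    (c : κ → σ →₀ ℕ) (hc : Function.Injective c) (hcs : ∀ e, e ∈ Set.range c ↔ ∀ i, ¬ s i ≤ e) :
    ∃ E : (MvPowerSeries σ F ⧸ Ideal.span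
        (Set.range fun i => (monomial (s i) (1 : F) : MvPowerSeries σ F))) ≃ₗ[F] (κ → F),
      ∀ g k, E (Ideal.Quotient.mk _ g) k = coeff (c k) g := by
  classical
  let I := Ideal.span (Set.range fun i => (monomial (s i) (1 : F) : MvPowerSeries σ F))
  let L : MvPowerSeries σ F →ₗ[F] (κ → F) := LinearMap.pi fun k => coeff (c k)
  have hker : I.restrictScalars F = LinearMap.ker L := by
    ext g
    rw [Submodule.restrictScalars_mem, mem_span_range_monomial_iff, LinearMap.mem_ker]
    constructor
    · intro h
      ext k
      exact h _ ((hcs _).1 ⟨k, rfl⟩)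
    · intro h e he
      obtain ⟨k, rfl⟩ := (hcs e).2 he
      exact congrFun h k
  have hsurj : Function.Surjective L := by
    intro v
    have := Fintype.ofFinite κ
    refine ⟨∑ k, monomial (c k) (v k), ?_⟩
    ext k
    simp only [L, LinearMap.pi_apply, map_sum, coeff_monomial, hc.eq_iff]
    simp
  exact ⟨(Submodule.Quotient.restrictScalarsEquiv F I).symm ≪≫ₗ
    Submodule.quotEquivOfEq _ _ hker ≪≫ₗ L.quotKerEquivOfSurjective hsurj, fun g k => rfl⟩

end MonomialIdeal

/-- Transvections diagonalize `A`, and this survives `φ`, which is injective and so keeps the number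
of nonzero diagonal entries. -/
theorem Matrix.rank_map_ringHom {m K L : Type*} [Fintype m] [Field K] [Field L] (φ : K →+* L)
    (A : Matrix m m K) : (A.map φ).rank = A.rank := by
  classical
  obtain ⟨P, Q, D, h⟩ := Matrix.Pivot.exists_list_transvec_mul_mul_list_transvec_eq_diagonal A
  set p := (P.map Matrix.TransvectionStruct.toMatrix).prod
  set q := (Q.map Matrix.TransvectionStruct.toMatrix).prod
  have hp : p.det = 1 := Matrix.TransvectionStruct.det_toMatrix_prod P
  have hq : q.det = 1 := Matrix.TransvectionStruct.det_toMatrix_prod Q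
  have h' : p.map φ * A.map φ * q.map φ = Matrix.diagonal fun i => φ (D i) := by
    rw [← Matrix.map_mul, ← Matrix.map_mul, h, Matrix.diagonal_map (map_zero φ)]
  have hdet : ∀ M : Matrix m m K, M.det = 1 → IsUnit (M.map φ).det := by
    intro M hM
    have := φ.map_det M
    rw [hM, map_one] at this
    rw [RingHom.mapMatrix_apply] at this
    rw [← this]
    exact isUnit_one
  rw [← Matrix.rank_mul_eq_right_of_isUnit_det _ (A.map φ) (hdet p hp),
    ← Matrix.rank_mul_eq_left_of_isUnit_det _ (p.map φ * A.map φ) (hdet q hq), h',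
    ← Matrix.rank_mul_eq_right_of_isUnit_det p A (hp ▸ isUnit_one),
    ← Matrix.rank_mul_eq_left_of_isUnit_det q (p * A) (hq ▸ isUnit_one), h,
    Matrix.rank_diagonal, Matrix.rank_diagonal]
  simp

theorem powNullity_toLin'_one {m K : Type*} [Fintype m] [DecidableEq m] [Field K]
    (A : Matrix m m K) : powNullity (Matrix.toLin' A) 1 = Fintype.card m - A.rank := by
  have := LinearMap.finrank_range_add_finrank_ker (Matrix.toLin' A)
  rw [Module.finrank_fintype_fun_eq_card] at this
  rw [powNullity, pow_one, Matrix.rank, ← Matrix.toLin'_apply']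
  omega

/-! ### Multiplication operators on truncated power series rings -/

/-- The ideal generated by the `2 ^ n`-th powers of the variables. -/
noncomputable abbrev frobIdeal (F σ : Type*) [Field F] (n : ℕ) : Ideal (MvPowerSeries σ F) :=
  Ideal.span (Set.range fun i : σ => (MvPowerSeries.X i : MvPowerSeries σ F) ^ 2 ^ n)

/-- The power series ring modulo the `2 ^ n`-th powers of the variables. -/
abbrev TruncRing (F σ : Type*) [Field F] (n : ℕ) : Type _ := MvPowerSeries σ F ⧸ frobIdeal F σ n

/-- Multiplication by `G` modulo the `2 ^ n`-th powers of the variables. -/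
noncomputable def mulOp {F σ : Type*} [Field F] (n : ℕ) (G : MvPowerSeries σ F) :
    Module.End F (TruncRing F σ n) :=
  LinearMap.mulLeft F (Ideal.Quotient.mk (frobIdeal F σ n) G)

section mulOp

open MvPowerSeries

variable {F σ τ : Type*} [Field F]

theorem mulOp_mk (n : ℕ) (G H : MvPowerSeries σ F) :
    mulOp n G (Ideal.Quotient.mk _ H) = Ideal.Quotient.mk _ (G * H) := rfl

theorem mulOp_apply (n : ℕ) (G : MvPowerSeries σ F) (x : TruncRing F σ n) :
    mulOp n G x = Ideal.Quotient.mk _ G * x := rfl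

theorem mulOp_pow (n : ℕ) (G : MvPowerSeries σ F) (k : ℕ) : mulOp n (G ^ k) = mulOp n G ^ k := by
  rw [mulOp, mulOp, LinearMap.pow_mulLeft, map_pow]

theorem powNullity_mulOp_pow (n : ℕ) (G : MvPowerSeries σ F) (j k : ℕ) :
    powNullity (mulOp n (G ^ j)) k = powNullity (mulOp n G) (j * k) := by
  rw [mulOp_pow, powNullity, powNullity, pow_mul]

theorem frobIdeal_eq (n : ℕ) : frobIdeal F σ n = Ideal.span (Set.range fun i : σ =>
    (monomial (Finsupp.single i (2 ^ n)) (1 : F) : MvPowerSeries σ F)) := by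
  simp only [frobIdeal, X_pow_eq]

theorem mem_frobIdeal_iff [Finite σ] (n : ℕ) (g : MvPowerSeries σ F) :
    g ∈ frobIdeal F σ n ↔ ∀ e : σ →₀ ℕ, (∀ i, e i < 2 ^ n) → coeff e g = 0 := by
  rw [frobIdeal_eq, mem_span_range_monomial_iff]
  simp only [Finsupp.single_le_iff, not_le]

/-- The exponent given by a family of natural numbers less than `q`. -/
noncomputable def boxExp [Finite σ] {q : ℕ} (a : σ → Fin q) : σ →₀ ℕ :=
  Finsupp.equivFunOnFinite.symm fun i => (a i : ℕ)

@[simp]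
theorem boxExp_apply [Finite σ] {q : ℕ} (a : σ → Fin q) (i : σ) : boxExp a i = a i := rfl

theorem boxExp_injective [Finite σ] {q : ℕ} :
    Function.Injective (boxExp : (σ → Fin q) → σ →₀ ℕ) := by
  intro a b h
  ext i
  exact DFunLike.congr_fun h i

theorem mem_range_boxExp [Finite σ] {q : ℕ} (e : σ →₀ ℕ) :
    e ∈ Set.range (boxExp : (σ → Fin q) → σ →₀ ℕ) ↔ ∀ i, e i < q := by
  constructor
  · rintro ⟨a, rfl⟩ i
    exact (a i).2
  · intro h
    exact ⟨fun i => ⟨e i, h i⟩, by ext i; rfl⟩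

theorem exists_truncRing_equiv (F σ : Type*) [Field F] [Finite σ] (n : ℕ) :
    ∃ E : TruncRing F σ n ≃ₗ[F] ((σ → Fin (2 ^ n)) → F),
      ∀ g a, E (Ideal.Quotient.mk _ g) a = coeff (boxExp a) g := by
  have h := exists_quotient_monomial_equiv (F := F)
    (fun i : σ => Finsupp.single i (2 ^ n)) (boxExp : (σ → Fin (2 ^ n)) → σ →₀ ℕ)
    boxExp_injective fun e => by
      simp only [mem_range_boxExp, Finsupp.single_le_iff, not_le]
  rw [← frobIdeal_eq] at h
  exact h

instance [Finite σ] (n : ℕ) : FiniteDimensional F (TruncRing F σ n) := by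
  obtain ⟨E, -⟩ := exists_truncRing_equiv F σ n
  exact Module.Finite.equiv E.symm

theorem finrank_truncRing [Fintype σ] (n : ℕ) :
    Module.finrank F (TruncRing F σ n) = (2 ^ n) ^ Fintype.card σ := by
  classical
  obtain ⟨E, -⟩ := exists_truncRing_equiv F σ n
  rw [E.finrank_eq]
  simp

/-- The quotient is the cokernel of multiplication by `G`, which has the dimension of the kernel. -/
theorem hilbertKunz_eq_powNullity [Finite σ] (G : MvPowerSeries σ F) (n : ℕ) :
    hilbertKunz G n = powNullity (mulOp n G) 1 := by
  have h1 := LinearMap.finrank_range_add_finrank_ker (mulOp n G)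
  have h2 := Submodule.finrank_quotient_add_finrank (LinearMap.range (mulOp n G))
  have h3 : hilbertKunz G n =
      Module.finrank F (TruncRing F σ n ⧸ LinearMap.range (mulOp n G)) := by
    unfold hilbertKunz hkIdeal
    rw [← (DoubleQuot.quotQuotEquivQuotSupₐ F (frobIdeal F σ n)
      (Ideal.span {G})).toLinearEquiv.finrank_eq]
    have h4 : (Ideal.map (Ideal.Quotient.mkₐ F (frobIdeal F σ n)) (Ideal.span {G})).restrictScalars
        F = LinearMap.range (mulOp n G) := by
      ext x
      rw [Submodule.restrictScalars_mem, Ideal.map_span, Set.image_singleton,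
        Ideal.mem_span_singleton, LinearMap.mem_range]
      constructor
      · rintro ⟨y, rfl⟩
        exact ⟨y, rfl⟩
      · rintro ⟨y, rfl⟩
        exact ⟨y, rfl⟩
    rw [← h4]
    exact (Submodule.Quotient.restrictScalarsEquiv F _).symm.finrank_eq
  rw [powNullity, pow_one]
  omega

theorem hilbertKunz_pow [Finite σ] (G : MvPowerSeries σ F) (n k : ℕ) :
    hilbertKunz (G ^ k) n = powNullity (mulOp n G) k := by
  rw [hilbertKunz_eq_powNullity, powNullity_mulOp_pow, mul_one]

/-- By Frobenius, all exponents in `G ^ 2 ^ n` are multiples of `2 ^ n`, and the constant term is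
zero. -/
theorem mulOp_pow_eq_zero [CharP F 2] [Finite σ] (n : ℕ) {G : MvPowerSeries σ F}
    (hG : constantCoeff G = 0) : mulOp n G ^ 2 ^ n = 0 := by
  have hmem : G ^ 2 ^ n ∈ frobIdeal F σ n := by
    rw [mem_frobIdeal_iff]
    intro e he
    rw [← map_iterateFrobenius_expand 2 two_ne_zero, coeff_map]
    by_cases h0 : e = 0
    · rw [h0, coeff_zero_eq_constantCoeff, constantCoeff_expand, hG, map_zero]
    · obtain ⟨i, hi⟩ := DFunLike.ne_iff.1 h0
      rw [coeff_expand_of_not_dvd (i := i), map_zero]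
      exact fun h => absurd (Nat.le_of_dvd (Nat.pos_of_ne_zero hi) h) (not_le.2 (he i))
  rw [← mulOp_pow, mulOp, Ideal.Quotient.eq_zero_iff_mem.2 hmem]
  exact LinearMap.mulLeft_zero_eq_zero F _

theorem hilbertKunz_rename [Finite σ] [Finite τ] (e : σ ≃ τ) (G : MvPowerSeries σ F) (n : ℕ) :
    hilbertKunz (rename e G) n = hilbertKunz G n := by
  unfold hilbertKunz
  symm
  refine (Ideal.quotientEquivAlg (hkIdeal G n) (hkIdeal (rename e G) n) (renameEquiv F e)
    ?_).toLinearEquiv.finrank_eq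
  unfold hkIdeal
  rw [Ideal.map_sup, Ideal.map_span, Ideal.map_span, Set.image_singleton, ← Set.range_comp]
  congr 2
  rw [← e.surjective.range_comp]
  congr 1
  ext1 i
  simp

end mulOp

/-! ### Sums of power series in disjoint variables -/

section tensor

open MvPowerSeries TensorProduct

variable {F σ τ : Type*} [Field F]

/-- Renaming of variables, modulo the `2 ^ n`-th powers of the variables. -/
noncomputable def truncRename [Finite σ] (f : σ → τ) (n : ℕ) :
    TruncRing F σ n →ₐ[F] TruncRing F τ n :=
  Ideal.quotientMapₐ _ (rename f) <| by
    rw [Ideal.span_le]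
    rintro _ ⟨i, rfl⟩
    exact Ideal.subset_span ⟨f i, by simp⟩

theorem truncRename_mk [Finite σ] (f : σ → τ) (n : ℕ) (g : MvPowerSeries σ F) :
    truncRename f n (Ideal.Quotient.mk _ g) = Ideal.Quotient.mk _ (rename f g) := rfl

theorem subalgebra_truncRing_eq_top [Finite σ] {n : ℕ} (A : Subalgebra F (TruncRing F σ n))
    (hA : ∀ i, Ideal.Quotient.mk _ (X i) ∈ A) : A = ⊤ := by
  classical
  have := Fintype.ofFinite σ
  rw [eq_top_iff]
  intro x _
  obtain ⟨g, rfl⟩ := Ideal.Quotient.mk_surjective x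
  have hmon : ∀ e : σ →₀ ℕ, Ideal.Quotient.mk (frobIdeal F σ n) (monomial e 1) ∈ A := by
    intro e
    rw [monomial_one_eq, Finsupp.prod, map_prod]
    exact prod_mem fun i _ => by rw [map_pow]; exact pow_mem (hA i) _
  have hg : Ideal.Quotient.mk (frobIdeal F σ n) g =
      ∑ a : σ → Fin (2 ^ n), coeff (boxExp a) g •
        Ideal.Quotient.mk (frobIdeal F σ n) (monomial (boxExp a) 1) := by
    obtain ⟨E, hE⟩ := exists_truncRing_equiv F σ n
    apply E.injective
    ext b
    simp [hE, coeff_monomial, boxExp_injective.eq_iff]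
  rw [hg]
  exact sum_mem fun a _ => A.smul_mem (hmon _) _

/-- The truncated power series ring in the disjoint union of two sets of variables is the tensor
product of the truncated power series rings. -/
noncomputable def truncTensor (F σ τ : Type*) [Field F] [Finite σ] [Finite τ] (n : ℕ) :
    TruncRing F σ n ⊗[F] TruncRing F τ n →ₐ[F] TruncRing F (σ ⊕ τ) n :=
  Algebra.TensorProduct.productMap (truncRename Sum.inl n) (truncRename Sum.inr n)

/-- The image contains all the variables, hence everything; the dimensions agree. -/
theorem truncTensor_bijective (F σ τ : Type*) [Field F] [Finite σ] [Finite τ] (n : ℕ) :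
    Function.Bijective (truncTensor F σ τ n) := by
  have := Fintype.ofFinite σ
  have := Fintype.ofFinite τ
  have hsurj : Function.Surjective (truncTensor F σ τ n) := by
    rw [← AlgHom.range_eq_top]
    apply subalgebra_truncRing_eq_top
    rintro (i | i)
    · exact ⟨Ideal.Quotient.mk _ (X i) ⊗ₜ 1, by simp [truncTensor, truncRename_mk]⟩
    · exact ⟨1 ⊗ₜ Ideal.Quotient.mk _ (X i), by simp [truncTensor, truncRename_mk]⟩
  refine ⟨?_, hsurj⟩
  have hdim : Module.finrank F (TruncRing F σ n ⊗[F] TruncRing F τ n) =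
      Module.finrank F (TruncRing F (σ ⊕ τ) n) := by
    rw [Module.finrank_tensorProduct, finrank_truncRing, finrank_truncRing, finrank_truncRing,
      Fintype.card_sum, pow_add]
  exact (LinearMap.injective_iff_surjective_of_finrank_eq_finrank hdim
    (f := (truncTensor F σ τ n).toLinearMap)).2 hsurj

theorem truncTensor_tensorAdd [Finite σ] [Finite τ] (n : ℕ) (f : MvPowerSeries σ F)
    (g : MvPowerSeries τ F) (x : TruncRing F σ n ⊗[F] TruncRing F τ n) :
    truncTensor F σ τ n (tensorAdd (mulOp n f) (mulOp n g) x) =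
      mulOp n (rename Sum.inl f + rename Sum.inr g) (truncTensor F σ τ n x) := by
  induction x with
  | zero => simp
  | add x y hx hy => rw [map_add, map_add, map_add, map_add, hx, hy]
  | tmul v w =>
    rw [mulOp_apply, map_add, tensorAdd, LinearMap.add_apply, LinearMap.rTensor_tmul,
      LinearMap.lTensor_tmul, map_add]
    simp only [truncTensor, Algebra.TensorProduct.productMap_apply_tmul, mulOp_apply, map_mul,
      truncRename_mk]
    ring

theorem powNullity_mulOp_add [Finite σ] [Finite τ] (n : ℕ) (f : MvPowerSeries σ F)
    (g : MvPowerSeries τ F) :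
    powNullity (mulOp n (rename Sum.inl f + rename Sum.inr g : MvPowerSeries (σ ⊕ τ) F)) =
      powNullity (tensorAdd (mulOp n f) (mulOp n g)) :=
  (powNullity_eq_of_equiv (LinearEquiv.ofBijective (truncTensor F σ τ n).toLinearMap
    (truncTensor_bijective F σ τ n)) fun x => truncTensor_tensorAdd n f g x).symm

/-- The number of odd Jordan blocks of multiplication by `f(x) + g(y)`, in characteristic 2. -/
theorem oddBlocks_mulOp_add [CharP F 2] [Finite σ] [Finite τ] (n : ℕ) {f : MvPowerSeries σ F}
    {g : MvPowerSeries τ F} (hf : constantCoeff f = 0) (hg : constantCoeff g = 0) :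
    oddBlocks (mulOp n (rename Sum.inl f + rename Sum.inr g : MvPowerSeries (σ ⊕ τ) F)) (2 ^ n) =
      oddBlocks (mulOp n f) (2 ^ n) * oddBlocks (mulOp n g) (2 ^ n) := by
  rw [← oddBlocks_tensorAdd (mulOp_pow_eq_zero n hf) (mulOp_pow_eq_zero n hg)]
  simp only [oddBlocks, powNullity_mulOp_add]

/-- The Hilbert–Kunz function of `f(x) + g(y)`. -/
theorem hilbertKunz_add [CharP F 2] [Finite σ] [Finite τ] (n : ℕ) {f : MvPowerSeries σ F}
    (hf : constantCoeff f = 0) (g : MvPowerSeries τ F) :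
    (hilbertKunz (rename Sum.inl f + rename Sum.inr g : MvPowerSeries (σ ⊕ τ) F) n : ℤ) =
      ∑ i ∈ Finset.range (2 ^ n),
        ((powNullity (mulOp n f) (i + 1) : ℤ) - powNullity (mulOp n f) i) *
          ((powNullity (mulOp n g) (i + 1) : ℤ) - powNullity (mulOp n g) i) := by
  rw [hilbertKunz_eq_powNullity, powNullity_mulOp_add,
    powNullity_tensorAdd_one (mulOp_pow_eq_zero n hf)]

end tensor

/-! ### The Jordan types of `uv` and of a single variable -/

section monomial

open MvPowerSeries

variable {F : Type*} [Field F]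

/-- The nullity counts the monomials in the `q × q` box not divisible by `(uv) ^ k`; the divisible
ones form a square of side `q - k`. The truncated subtraction is right for `k > q`. -/
theorem powNullity_mulOp_X_mul_X (n k : ℕ) :
    powNullity (mulOp n (X 0 * X 1 : MvPowerSeries (Fin 2) F)) k + (2 ^ n - k) ^ 2 =
      (2 ^ n) ^ 2 := by
  classical
  let s : Option (Fin 2) → Fin 2 →₀ ℕ := fun o => o.elim
    (Finsupp.single 0 k + Finsupp.single 1 k) fun i => Finsupp.single i (2 ^ n)
  let κ := {a : Fin 2 → Fin (2 ^ n) // ¬ (k ≤ a 0 ∧ k ≤ a 1)}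
  have hideal : hkIdeal ((X 0 * X 1 : MvPowerSeries (Fin 2) F) ^ k) n = Ideal.span
      (Set.range fun o => (monomial (s o) (1 : F) : MvPowerSeries (Fin 2) F)) := by
    rw [hkIdeal, ← Ideal.span_union, mul_pow]
    congr 1
    ext g
    simp only [Set.mem_union, Set.mem_range, Set.mem_singleton_iff, Option.exists, s,
      Option.elim_none, Option.elim_some, X_pow_eq, monomial_mul_monomial, mul_one]
    rw [or_comm, eq_comm (a := g)]
  obtain ⟨E, -⟩ := exists_quotient_monomial_equiv (F := F) s (fun a : κ => boxExp a.1)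
    (boxExp_injective.comp Subtype.val_injective) (fun e => by
      simp only [Option.forall, s, Option.elim_none, Option.elim_some, Finsupp.single_le_iff,
        not_le, ← mem_range_boxExp (q := 2 ^ n)]
      have h01 : Finsupp.single 0 k + Finsupp.single 1 k ≤ e ↔ k ≤ e 0 ∧ k ≤ e 1 := by
        rw [Finsupp.le_def, Fin.forall_fin_two]
        simp
      rw [h01]
      constructor
      · rintro ⟨a, rfl⟩
        exact ⟨a.2, a.1, rfl⟩
      · rintro ⟨h, a, rfl⟩
        exact ⟨⟨a, h⟩, rfl⟩)
  have h1 : powNullity (mulOp n (X 0 * X 1 : MvPowerSeries (Fin 2) F)) k = Fintype.card κ := by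
    rw [← hilbertKunz_pow, hilbertKunz, hideal, E.finrank_eq, Module.finrank_fintype_fun_eq_card]
  have h2 : Fintype.card {a : Fin 2 → Fin (2 ^ n) // k ≤ a 0 ∧ k ≤ a 1} = (2 ^ n - k) ^ 2 := by
    have e : {a : Fin 2 → Fin (2 ^ n) // k ≤ a 0 ∧ k ≤ a 1} ≃
        (Fin 2 → {j : Fin (2 ^ n) // k ≤ j}) :=
      (Equiv.subtypeEquivRight fun a : Fin 2 → Fin (2 ^ n) =>
        (Fin.forall_fin_two (p := fun i => k ≤ (a i : ℕ))).symm).trans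
        (Equiv.subtypePiEquivPi (β := fun _ : Fin 2 => Fin (2 ^ n)) (p := fun _ j => k ≤ (j : ℕ)))
    rw [Fintype.card_congr e, Fintype.card_fun, Fintype.card_fin]
    congr 1
    rw [Fintype.card_subtype]
    rw [← Finset.card_map Fin.valEmbedding]
    rw [← Nat.card_Ico]
    congr 1
    ext j
    simp only [Finset.mem_map, Finset.mem_filter, Finset.mem_univ, true_and,
      Fin.valEmbedding_apply, Finset.mem_Ico]
    constructor
    · rintro ⟨a, ha, rfl⟩
      exact ⟨ha, a.2⟩
    · rintro ⟨ha, hb⟩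
      exact ⟨⟨j, hb⟩, ha, rfl⟩
  have h3 := Fintype.card_subtype_compl fun a : Fin 2 → Fin (2 ^ n) => k ≤ a 0 ∧ k ≤ a 1
  have h4 := Fintype.card_subtype_le fun a : Fin 2 → Fin (2 ^ n) => k ≤ a 0 ∧ k ≤ a 1
  rw [h2] at h3 h4
  rw [h1]
  have h5 : Fintype.card (Fin 2 → Fin (2 ^ n)) = (2 ^ n) ^ 2 := by simp
  rw [h5] at h3 h4
  have h6 : Fintype.card κ = (2 ^ n) ^ 2 - (2 ^ n - k) ^ 2 := by convert! h3
  omega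

theorem powNullity_mulOp_X (n k : ℕ) :
    powNullity (mulOp n (X 0 : MvPowerSeries (Fin 1) F)) k = min k (2 ^ n) := by
  let s : Option (Fin 1) → Fin 1 →₀ ℕ := fun o => o.elim
    (Finsupp.single 0 k) fun i => Finsupp.single i (2 ^ n)
  have hideal : hkIdeal ((X 0 : MvPowerSeries (Fin 1) F) ^ k) n = Ideal.span
      (Set.range fun o => (monomial (s o) (1 : F) : MvPowerSeries (Fin 1) F)) := by
    rw [hkIdeal, ← Ideal.span_union]
    congr 1
    ext g
    simp only [Set.mem_union, Set.mem_range, Set.mem_singleton_iff, Option.exists, s,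
      Option.elim_none, Option.elim_some, X_pow_eq]
    rw [or_comm, eq_comm (a := g)]
  obtain ⟨E, -⟩ := exists_quotient_monomial_equiv (F := F) s
    (fun a : Fin 1 → Fin (min k (2 ^ n)) => boxExp a) boxExp_injective (fun e => by
      simp only [Option.forall, s, Option.elim_none, Option.elim_some, Finsupp.single_le_iff,
        not_le]
      rw [mem_range_boxExp, Fin.forall_fin_one, Fin.forall_fin_one, lt_min_iff])
  rw [← hilbertKunz_pow, hilbertKunz, hideal, E.finrank_eq, Module.finrank_fintype_fun_eq_card]
  simp

end monomial

/-! ### Passing from level `n` to level `n + 1` by Frobenius -/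

section frobenius

open MvPowerSeries

variable {F σ : Type*} [Field F]

/-- The matrix of the multiplication by `h` with respect to the monomials. -/
noncomputable def truncMatrix [Finite σ] (n : ℕ) (h : MvPowerSeries σ F) :
    Matrix (σ → Fin (2 ^ n)) (σ → Fin (2 ^ n)) F := by
  classical
  exact Matrix.of fun a b => if boxExp b ≤ boxExp a then coeff (boxExp a - boxExp b) h else 0

theorem powNullity_truncMatrix [Fintype σ] [DecidableEq σ] (n : ℕ) (h : MvPowerSeries σ F) :
    powNullity (mulOp n h) = powNullity (Matrix.toLin' (truncMatrix n h)) := by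
  classical
  obtain ⟨E, hE⟩ := exists_truncRing_equiv F σ n
  have hsymm : ∀ b, E.symm (Pi.single b 1) = Ideal.Quotient.mk _ (monomial (boxExp b) 1) := by
    intro b
    rw [LinearEquiv.symm_apply_eq]
    ext a
    rw [hE, coeff_monomial, Pi.single_apply]
    simp [boxExp_injective.eq_iff]
  refine powNullity_eq_of_equiv E fun x => ?_
  obtain ⟨v, rfl⟩ := E.symm.surjective x
  rw [LinearEquiv.apply_symm_apply]
  suffices E.toLinearMap.comp ((mulOp n h).comp E.symm.toLinearMap) =
    Matrix.toLin' (truncMatrix n h) from LinearMap.congr_fun this v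
  refine LinearMap.pi_ext' fun b => LinearMap.ext_ring ?_
  ext a
  simp only [LinearMap.comp_apply, LinearMap.single_apply, LinearEquiv.coe_coe, hsymm, mulOp_mk,
    hE, Matrix.toLin'_apply, Matrix.mulVec_single_one, Matrix.col_apply, truncMatrix,
    Matrix.of_apply, coeff_mul_monomial, mul_one]

/-- Monomials are sorted by the parities of their exponents. Since `h ^ 2` has only even exponents
and squared coefficients, its matrix is block diagonal, with `2 ^ s` copies of the Frobenius twist
of the matrix of `h`. The twist keeps the rank, so `F` need not be perfect. -/
theorem powNullity_mulOp_sq [CharP F 2] [Fintype σ] (n : ℕ) (h : MvPowerSeries σ F) :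
    powNullity (mulOp (n + 1) (h ^ 2)) 1 = 2 ^ Fintype.card σ * powNullity (mulOp n h) 1 := by
  classical
  -- The exponent `2 b + ε`, with `ε` the vector of parities.
  let c : (σ → Fin 2) × (σ → Fin (2 ^ n)) → σ →₀ ℕ := fun p => 2 • boxExp p.2 + boxExp p.1
  have hcapp : ∀ p i, c p i = 2 * (p.2 i : ℕ) + p.1 i := fun p i => by simp [c]
  have hc : Function.Injective c := by
    rintro ⟨ε, a⟩ ⟨ε', b⟩ hp
    have key : ∀ i, ε i = ε' i ∧ a i = b i := by
      intro i
      have := DFunLike.congr_fun hp i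
      rw [hcapp, hcapp] at this
      simp only [Fin.ext_iff] at this ⊢
      omega
    exact Prod.ext (funext fun i => (key i).1) (funext fun i => (key i).2)
  have hcr : ∀ e, e ∈ Set.range c ↔ ∀ i, ¬ Finsupp.single i (2 ^ (n + 1)) ≤ e := by
    intro e
    simp only [Finsupp.single_le_iff, not_le]
    constructor
    · rintro ⟨p, rfl⟩ i
      rw [hcapp, pow_succ]
      omega
    · intro he
      have he' : ∀ i, e i / 2 < 2 ^ n := fun i => by
        have := he i
        rw [pow_succ] at this
        omega
      refine ⟨(fun i => ⟨e i % 2, Nat.mod_lt _ two_pos⟩, fun i => ⟨e i / 2, he' i⟩), ?_⟩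
      ext i
      rw [hcapp]
      simp only
      omega
  have hex := exists_quotient_monomial_equiv (F := F)
    (fun i : σ => Finsupp.single i (2 ^ (n + 1))) c hc hcr
  rw [← frobIdeal_eq] at hex
  obtain ⟨E, hE⟩ := hex
  let A : Matrix (σ → Fin (2 ^ n)) (σ → Fin (2 ^ n)) F := (truncMatrix n h).map (frobenius F 2)
  have hcoeff : ∀ ε a ε' b, (if c (ε', b) ≤ c (ε, a) then coeff (c (ε, a) - c (ε', b)) (h ^ 2)
      else 0) = if ε = ε' then A a b else 0 := by
    intro ε a ε' b
    rw [← map_frobenius_expand 2 two_ne_zero, coeff_map]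
    split_ifs with h1 h2 h2
    · subst h2
      have h3 : c (ε, a) - c (ε, b) = 2 • (boxExp a - boxExp b) := by
        ext i
        simp only [Finsupp.coe_tsub, Pi.sub_apply, hcapp, Finsupp.coe_smul, Pi.smul_apply,
          boxExp_apply, smul_eq_mul]
        omega
      have h4 : boxExp b ≤ boxExp a := by
        intro i
        have := h1 i
        rw [hcapp, hcapp] at this
        simp only [boxExp_apply]
        simp only at this
        omega
      rw [h3, coeff_expand_smul]
      simp [A, truncMatrix, h4]
    · obtain ⟨i, hi⟩ := Function.ne_iff.1 h2
      rw [coeff_expand_of_not_dvd (i := i), map_zero]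
      have := h1 i
      rw [hcapp, hcapp] at this
      rw [Finsupp.coe_tsub, Pi.sub_apply, hcapp, hcapp]
      simp only at this ⊢
      rw [ne_eq, Fin.ext_iff] at hi
      have h5 := (ε i).2
      have h6 := (ε' i).2
      omega
    · subst h2
      have h4 : ¬ boxExp b ≤ boxExp a := by
        intro h4
        apply h1
        intro i
        have := h4 i
        simp only [boxExp_apply] at this
        rw [hcapp, hcapp]
        simp only
        omega
      simp [A, truncMatrix, h4]
    · rfl
  let e : TruncRing F σ (n + 1) ≃ₗ[F] ((σ → Fin 2) → (σ → Fin (2 ^ n)) → F) :=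
    E ≪≫ₗ LinearEquiv.curry F F (σ → Fin 2) (σ → Fin (2 ^ n))
  have hsymm : ∀ p, E.symm (Pi.single p 1) = Ideal.Quotient.mk _ (monomial (c p) 1) := by
    intro p
    rw [LinearEquiv.symm_apply_eq]
    ext q
    rw [hE, coeff_monomial, Pi.single_apply]
    simp [hc.eq_iff]
  have he : ∀ x ε, e (mulOp (n + 1) (h ^ 2) x) ε = Matrix.toLin' A (e x ε) := by
    intro x ε
    obtain ⟨v, rfl⟩ := E.symm.surjective x
    let L : ((σ → Fin 2) × (σ → Fin (2 ^ n)) → F) →ₗ[F] ((σ → Fin (2 ^ n)) → F) :=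
      (LinearMap.proj ε).comp (e.toLinearMap.comp ((mulOp (n + 1) (h ^ 2)).comp E.symm.toLinearMap))
    let R : ((σ → Fin 2) × (σ → Fin (2 ^ n)) → F) →ₗ[F] ((σ → Fin (2 ^ n)) → F) :=
      (Matrix.toLin' A).comp ((LinearMap.proj ε).comp (e.toLinearMap.comp E.symm.toLinearMap))
    suffices L = R from LinearMap.congr_fun this v
    refine LinearMap.pi_ext' fun p => LinearMap.ext_ring ?_
    obtain ⟨ε', b⟩ := p
    ext a
    have hL : L (Pi.single (ε', b) 1) a = if ε = ε' then A a b else 0 := by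
      change E (mulOp (n + 1) (h ^ 2) (E.symm (Pi.single (ε', b) 1))) (ε, a) = _
      rw [hsymm, mulOp_mk, hE, coeff_mul_monomial, mul_one, hcoeff]
    have hR : R (Pi.single (ε', b) 1) a = if ε = ε' then A a b else 0 := by
      change Matrix.toLin' A (fun a' => E (E.symm (Pi.single (ε', b) 1)) (ε, a')) a = _
      rw [LinearEquiv.apply_symm_apply]
      split_ifs with h2
      · subst h2
        have : (fun a' => (Pi.single (ε, b) 1 : (σ → Fin 2) × (σ → Fin (2 ^ n)) → F) (ε, a')) =
            Pi.single b 1 := by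
          ext a'
          simp [Pi.single_apply]
        rw [this, Matrix.toLin'_apply, Matrix.mulVec_single_one, Matrix.col_apply]
      · have : (fun a' => (Pi.single (ε', b) 1 : (σ → Fin 2) × (σ → Fin (2 ^ n)) → F) (ε, a')) =
            0 := by
          ext a'
          simp [h2]
        rw [this, map_zero]
        rfl
    exact hL.trans hR.symm
  rw [powNullity_eq_sum_of_equiv e he, powNullity_truncMatrix, powNullity_toLin'_one,
    powNullity_toLin'_one, Matrix.rank_map_ringHom, Finset.sum_const, Finset.card_univ,
    Fintype.card_fun, Fintype.card_fin, smul_eq_mul]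

theorem powNullity_mulOp_two_mul [CharP F 2] [Fintype σ] (n : ℕ) (f : MvPowerSeries σ F) (j : ℕ) :
    powNullity (mulOp (n + 1) f) (2 * j) = 2 ^ Fintype.card σ * powNullity (mulOp n f) j := by
  have h := powNullity_mulOp_sq n (f ^ j)
  rwa [← pow_mul, powNullity_mulOp_pow, powNullity_mulOp_pow, mul_one, mul_one, mul_comm] at h

end frobenius

/-! ### Counting odd blocks, and the multiplicity of `uv + f` -/

section theta

open MvPowerSeries

variable {F σ τ : Type*} [Field F]

/-- The number of Jordan blocks of odd size of the multiplication by `f` modulo the `2 ^ n`-th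
powers of the variables. -/
noncomputable def oddCount (f : MvPowerSeries σ F) (n : ℕ) : ℤ := oddBlocks (mulOp n f) (2 ^ n)

/-- The power series `uv + f`, with `u` and `v` two new variables. -/
noncomputable def uvSum [Finite σ] (f : MvPowerSeries σ F) : MvPowerSeries (σ ⊕ Fin 2) F :=
  X (Sum.inr 0) * X (Sum.inr 1) + rename (Sum.inl : σ → σ ⊕ Fin 2) f

theorem constantCoeff_uvSum [Finite σ] (f : MvPowerSeries σ F) :
    constantCoeff (uvSum f) = constantCoeff f := by simp [uvSum]

theorem uvSum_ne_zero [Finite σ] (f : MvPowerSeries σ F) : uvSum f ≠ 0 := by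
  classical
  intro h
  have h1 := congrArg (coeff (Finsupp.single (Sum.inr 0) 1 + Finsupp.single (Sum.inr 1) 1)) h
  rw [uvSum, map_add, coeff_rename_eq_zero, X, X, monomial_mul_monomial] at h1
  · simp at h1
  · rintro ⟨x, hx⟩
    have := DFunLike.congr_fun hx (Sum.inr 0)
    rw [Finsupp.mapDomain_of_notMem_range _ _ (by simp)] at this
    simp at this

/-- The weight is the increment of the nullities of `uv`: `(q - i) ^ 2 - (q - i - 1) ^ 2 = 2 (q - i)
- 1`. -/
theorem hilbertKunz_uvSum [CharP F 2] [Finite σ] (n : ℕ) {f : MvPowerSeries σ F}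
    (hf : constantCoeff f = 0) :
    (hilbertKunz (uvSum f) n : ℤ) = ∑ i ∈ Finset.range (2 ^ n), (2 * (2 ^ n - i) - 1) *
      ((powNullity (mulOp n f) (i + 1) : ℤ) - powNullity (mulOp n f) i) := by
  have h : uvSum f = rename Sum.inl f + rename Sum.inr (X 0 * X 1 : MvPowerSeries (Fin 2) F) := by
    rw [uvSum, map_mul, rename_X, rename_X, add_comm]
  rw [h, hilbertKunz_add n hf]
  apply Finset.sum_congr rfl
  intro i hi
  rw [Finset.mem_range] at hi
  rw [mul_comm]
  congr 1
  have h1 := powNullity_mulOp_X_mul_X (F := F) n i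
  have h2 := powNullity_mulOp_X_mul_X (F := F) n (i + 1)
  zify [hi.le, Nat.succ_le_of_lt hi] at h1 h2
  linear_combination h2 - h1

theorem hilbertKunz_uvSum_zero [CharP F 2] [Finite σ] {f : MvPowerSeries σ F}
    (hf : constantCoeff f = 0) : (hilbertKunz (uvSum f) 0 : ℤ) = oddCount f 0 := by
  rw [hilbertKunz_uvSum 0 hf]
  simp [oddCount, oddBlocks]

theorem sum_range_two_mul {M : Type*} [AddCommMonoid M] (g : ℕ → M) (N : ℕ) :
    ∑ i ∈ Finset.range (2 * N), g i = ∑ i ∈ Finset.range N, (g (2 * i) + g (2 * i + 1)) := by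
  induction N with
  | zero => simp
  | succ N ih =>
    rw [show 2 * (N + 1) = 2 * N + 1 + 1 by ring, Finset.sum_range_succ, Finset.sum_range_succ,
      Finset.sum_range_succ, ih, add_assoc]

/-- With `q = 2 ^ n`, the weights at `2 i` and `2 i + 1` are `2 (2 (q - i) - 1) ± 1`. The common
part meets a difference of nullities at even indices, which Frobenius takes to level `n`; the signs
`± 1` produce the alternating sum of `oddBlocks`. -/
theorem hilbertKunz_uvSum_succ [CharP F 2] [Fintype σ] (n : ℕ) {f : MvPowerSeries σ F}
    (hf : constantCoeff f = 0) :
    (hilbertKunz (uvSum f) (n + 1) : ℤ) =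
      2 ^ (Fintype.card σ + 1) * hilbertKunz (uvSum f) n + oddCount f (n + 1) := by
  rw [hilbertKunz_uvSum _ hf, hilbertKunz_uvSum _ hf, oddCount, oddBlocks, pow_succ' 2 n,
    sum_range_two_mul, sum_range_two_mul, Finset.mul_sum, ← Finset.sum_add_distrib]
  apply Finset.sum_congr rfl
  intro i _
  have h1 := powNullity_mulOp_two_mul n f i
  have h2 := powNullity_mulOp_two_mul n f (i + 1)
  rw [show 2 * (i + 1) = 2 * i + 1 + 1 by ring] at h2
  have h3 : (-1 : ℤ) ^ (2 * i) = 1 := by rw [pow_mul]; simp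
  rw [pow_succ (-1 : ℤ), h3]
  zify at h1 h2
  push_cast
  rw [h1, h2]
  ring

theorem abs_oddCount_le [Fintype σ] (f : MvPowerSeries σ F) (n : ℕ) :
    |oddCount f n| ≤ (2 ^ n) ^ Fintype.card σ := by
  have h := abs_oddBlocks_le (mulOp n f) (2 ^ n)
  rw [finrank_truncRing] at h
  exact_mod_cast h

theorem oddCount_zero [CharP F 2] [Finite σ] {f : MvPowerSeries σ F} (hf : constantCoeff f = 0) :
    oddCount f 0 = 1 := by
  have := Fintype.ofFinite σ
  have h := mulOp_pow_eq_zero 0 hf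
  rw [pow_zero] at h
  rw [oddCount, oddBlocks, pow_zero, Finset.sum_range_one, zero_add,
    powNullity_of_pow_eq_zero _ h, powNullity_zero, finrank_truncRing]
  simp

theorem oddCount_add [CharP F 2] [Finite σ] [Finite τ] (n : ℕ) {f : MvPowerSeries σ F}
    {g : MvPowerSeries τ F} (hf : constantCoeff f = 0) (hg : constantCoeff g = 0) :
    oddCount (rename Sum.inl f + rename Sum.inr g : MvPowerSeries (σ ⊕ τ) F) n =
      oddCount f n * oddCount g n := oddBlocks_mulOp_add n hf hg

theorem oddCount_sq_succ [CharP F 2] [Fintype σ] (n : ℕ) {f : MvPowerSeries σ F}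
    (hf : constantCoeff f = 0) :
    oddCount (f ^ 2) (n + 1) = 2 ^ Fintype.card σ * oddCount f n := by
  rw [oddCount, oddCount, ← oddBlocks_eq_of_le (mulOp_pow_eq_zero n hf)
    (Nat.pow_le_pow_right two_pos n.le_succ), oddBlocks, oddBlocks, Finset.mul_sum]
  apply Finset.sum_congr rfl
  intro i _
  rw [powNullity_mulOp_pow, powNullity_mulOp_pow, powNullity_mulOp_two_mul,
    powNullity_mulOp_two_mul]
  push_cast
  ring

/-- The multiplication by `x ^ k` in one variable has `k - r` blocks of size `A` and `r` blocks of
size `A + 1`, where `2 ^ n = k A + r`. -/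
theorem oddCount_X_pow {n k A r : ℕ} (hk : 2 ≤ k) (hr : r < k) (h : 2 ^ n = k * A + r) :
    oddCount (X 0 ^ k : MvPowerSeries (Fin 1) F) n = if Odd A then (k : ℤ) - r else r := by
  have hpow : 0 < 2 ^ n := by positivity
  -- The range of the alternating sum must reach the largest block size; this uses `2 ≤ k`.
  have hA : A + 1 ≤ 2 ^ n := by
    rcases A.eq_zero_or_pos with rfl | hA
    · omega
    · nlinarith
  have hterm : ∀ i, powNullity (mulOp n (X 0 ^ k : MvPowerSeries (Fin 1) F)) i =
      min (k * i) (k * A + r) := fun i => by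
    rw [powNullity_mulOp_pow, powNullity_mulOp_X, h]
  rw [oddCount, oddBlocks, ← Finset.sum_range_add_sum_Ico _ hA,
    Finset.sum_eq_zero (s := Finset.Ico _ _), add_zero, Finset.sum_range_succ]
  · rw [Finset.sum_congr rfl (g := fun i => (-1 : ℤ) ^ i * k), ← Finset.sum_mul]
    · rw [neg_one_geom_sum, hterm, hterm, min_eq_right (by rw [mul_add]; omega),
        min_eq_left (by omega)]
      rcases Nat.even_or_odd A with hA | hA
      · simp [hA.neg_one_pow, Nat.not_odd_iff_even.2 hA, hA]
      · simp [hA.neg_one_pow, Nat.not_even_iff_odd.2 hA, hA]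
        ring
    · intro i hi
      rw [Finset.mem_range] at hi
      have : k * (i + 1) ≤ k * A := Nat.mul_le_mul_left k hi
      rw [hterm, hterm, min_eq_left (by omega), min_eq_left (by rw [mul_add] at this; omega)]
      push_cast
      ring
  · intro i hi
    rw [Finset.mem_Ico] at hi
    have h1 : k * (A + 1) ≤ k * i := Nat.mul_le_mul_left k hi.1
    rw [hterm, hterm, min_eq_right (by rw [mul_add] at *; omega),
      min_eq_right (by rw [mul_add] at *; omega), sub_self, mul_zero]

/-- Either the quotient of `2 ^ (n + 1)` by 3 is even with remainder 2, or it is odd with remainder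
1 and the count is `3 - 1`. -/
theorem oddCount_X_pow_three (n : ℕ) :
    oddCount (X 0 ^ 3 : MvPowerSeries (Fin 1) F) (n + 1) = 2 := by
  have hmod : 2 ^ (n + 1) % 6 = 2 ∨ 2 ^ (n + 1) % 6 = 4 := by
    induction n with
    | zero => simp
    | succ n ih => rw [pow_succ]; omega
  rcases hmod with h | h
  · rw [oddCount_X_pow (A := 2 * (2 ^ (n + 1) / 6)) (r := 2) (by norm_num) (by norm_num) (by omega),
      if_neg (by simp)]
    rfl
  · rw [oddCount_X_pow (A := 2 * (2 ^ (n + 1) / 6) + 1) (r := 1) (by norm_num) (by norm_num)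
      (by omega), if_pos (by simp)]
    rfl

/-- Modulo 10, odd powers of 2 are 2 or 8, giving the counts `2` and `5 - 3`; positive even powers
are 4 or 6, giving `4` and `5 - 1`. -/
theorem oddCount_X_pow_five (n : ℕ) :
    oddCount (X 0 ^ 5 : MvPowerSeries (Fin 1) F) (2 * n + 1) = 2 ∧
      oddCount (X 0 ^ 5 : MvPowerSeries (Fin 1) F) (2 * n + 2) = 4 := by
  have hmod : 2 ^ (2 * n + 1) % 10 = 2 ∨ 2 ^ (2 * n + 1) % 10 = 8 := by
    induction n with
    | zero => simp
    | succ n ih => rw [show 2 * (n + 1) + 1 = 2 * n + 1 + 2 by ring, pow_add]; omega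
  have h2 : 2 ^ (2 * n + 2) = 2 ^ (2 * n + 1) * 2 := pow_succ _ _
  rcases hmod with h | h
  · constructor
    · rw [oddCount_X_pow (A := 2 * (2 ^ (2 * n + 1) / 10)) (r := 2) (by norm_num) (by norm_num)
        (by omega), if_neg (by simp)]
      rfl
    · rw [oddCount_X_pow (A := 2 * (2 ^ (2 * n + 2) / 10)) (r := 4) (by norm_num) (by norm_num)
        (by omega), if_neg (by simp)]
      rfl
  · constructor
    · rw [oddCount_X_pow (A := 2 * (2 ^ (2 * n + 1) / 10) + 1) (r := 3) (by norm_num) (by norm_num)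
        (by omega), if_pos (by simp)]
      rfl
    · rw [oddCount_X_pow (A := 2 * (2 ^ (2 * n + 2) / 10) + 1) (r := 1) (by norm_num) (by norm_num)
        (by omega), if_pos (by simp)]
      rfl

/-- The Hilbert–Kunz multiplicity of `uv + f`. -/
theorem exists_hasSum_oddCount [CharP F 2] [Fintype σ] {f : MvPowerSeries σ F}
    (hf : constantCoeff f = 0) : ∃ m, IsHilbertKunzMultiplicity F m ∧
      HasSum (fun n => (oddCount f n : ℝ) / 2 ^ ((Fintype.card σ + 1) * n)) m := by
  set s := Fintype.card σ with hs
  have hsum : Summable fun n => (oddCount f n : ℝ) / 2 ^ ((s + 1) * n) := by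
    refine Summable.of_norm_bounded (g := fun n => (1 / 2 : ℝ) ^ n) summable_geometric_two ?_
    intro n
    have h1 : |(oddCount f n : ℝ)| ≤ (2 ^ n) ^ s := by exact_mod_cast abs_oddCount_le f n
    rw [norm_div, Real.norm_eq_abs, norm_pow, Real.norm_two, div_le_iff₀ (by positivity)]
    calc |(oddCount f n : ℝ)| ≤ (2 ^ n) ^ s := h1
      _ = (1 / 2) ^ n * 2 ^ ((s + 1) * n) := by
        rw [add_mul, pow_add, one_mul, ← pow_mul, mul_comm n s, mul_comm (_ ^ (s * n)), ← mul_assoc,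
          ← mul_pow]
        norm_num
  refine ⟨_, ?_, hsum.hasSum⟩
  have hcard : Fintype.card (σ ⊕ Fin 2) = s + 1 + 1 := by simp [hs]
  let e : σ ⊕ Fin 2 ≃ Fin (s + 1 + 1) := Fintype.equivFinOfCardEq hcard
  refine ⟨s + 1, rename e (uvSum f), ?_, ?_, ?_⟩
  · exact (map_ne_zero_iff _ (renameEquiv F e).injective).2 (uvSum_ne_zero f)
  · rw [constantCoeff_rename, constantCoeff_uvSum, hf]
  · have h1 : ∀ n : ℕ, (hilbertKunz (rename e (uvSum f)) n : ℝ) / ((2 : ℝ) ^ n) ^ (s + 1) =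
        ∑ i ∈ Finset.range (n + 1), (oddCount f i : ℝ) / 2 ^ ((s + 1) * i) := by
      intro n
      rw [hilbertKunz_rename]
      induction n with
      | zero =>
        have := hilbertKunz_uvSum_zero hf
        simp only [zero_add, Finset.sum_range_one, pow_zero, one_pow, mul_zero, div_one]
        exact_mod_cast this
      | succ n ih =>
        have h2 : (hilbertKunz (uvSum f) (n + 1) : ℝ) =
            2 ^ (s + 1) * hilbertKunz (uvSum f) n + oddCount f (n + 1) := by
          exact_mod_cast hilbertKunz_uvSum_succ n hf
        rw [Finset.sum_range_succ, ← ih, h2, add_div, ← pow_mul, ← pow_mul, mul_comm (n + 1),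
          mul_comm n, mul_add, pow_add, mul_one]
        congr 1
        rw [div_eq_div_iff (by positivity) (by positivity)]
        ring
    simp only [h1]
    exact hsum.hasSum.tendsto_sum_nat.comp (Filter.tendsto_add_atTop_nat 1)

/-- The multiplicity of a regular ring; it absorbs the exceptional terms at `n = 0`. -/
theorem one_mem_hkSpan : (1 : ℝ) ∈ hkSpan F := by
  refine Submodule.subset_span ⟨0, X 0, ?_, constantCoeff_X _, ?_⟩
  · intro h
    have := congrArg (coeff (Finsupp.single 0 1)) h
    simp at this
  · have h : ∀ n, hilbertKunz (X 0 : MvPowerSeries (Fin (0 + 1)) F) n = 1 := by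
      intro n
      rw [hilbertKunz_eq_powNullity]
      refine (powNullity_mulOp_X n 1).trans ?_
      exact min_eq_left Nat.one_le_two_pow
    simp only [h]
    simp

end theta

/-! ### Separating parities and shifting indices -/

section main

open MvPowerSeries

variable {F : Type*} [Field F]

/-- The sums of `oddCount f n * oddCount g n / 2 ^ (8 n)` over the even, respectively odd, positive
integers `n` are rational combinations of Hilbert–Kunz multiplicities. -/
theorem exists_hasSum_oddCount_mul [CharP F 2] {f g : MvPowerSeries (Fin 3) F}
    (hf : constantCoeff f = 0) (hg : constantCoeff g = 0) :
    (∃ S ∈ hkSpan F, HasSum (fun n : ℕ =>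
      (oddCount f (2 * n + 1) : ℝ) * oddCount g (2 * n + 1) / 2 ^ (16 * n)) S) ∧
    (∃ S ∈ hkSpan F, HasSum (fun n : ℕ =>
      (oddCount f (2 * n + 2) : ℝ) * oddCount g (2 * n + 2) / 2 ^ (16 * n)) S) := by
  let b : ℕ → ℝ := fun n => (oddCount f n : ℝ) * oddCount g n / 2 ^ (8 * n)
  let c : ℕ → ℕ → ℤ := fun k n => oddCount (X 0 ^ k : MvPowerSeries (Fin 1) F) n
  have hX : ∀ k, k ≠ 0 → constantCoeff (X 0 ^ k : MvPowerSeries (Fin 1) F) = 0 := by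
    intro k hk
    rw [map_pow, constantCoeff_X, zero_pow hk]
  -- The series `f(x) + g(y) + t ^ k` has seven variables, hence the denominators `2 ^ (8 n)`.
  have hmult : ∀ k, k ≠ 0 → ∃ m ∈ hkSpan F, HasSum (fun n => (c k n : ℝ) * b n) m := by
    intro k hk
    have hfg : constantCoeff (rename Sum.inl f + rename Sum.inr g :
        MvPowerSeries (Fin 3 ⊕ Fin 3) F) = 0 := by simp [hf, hg]
    have hK : constantCoeff (rename Sum.inl (rename Sum.inl f + rename Sum.inr g :
        MvPowerSeries (Fin 3 ⊕ Fin 3) F) + rename Sum.inr (X 0 ^ k : MvPowerSeries (Fin 1) F) :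
        MvPowerSeries ((Fin 3 ⊕ Fin 3) ⊕ Fin 1) F) = 0 := by
      rw [map_add, constantCoeff_rename, constantCoeff_rename, hfg, hX k hk, add_zero]
    obtain ⟨m, hm, hsum⟩ := exists_hasSum_oddCount hK
    refine ⟨m, Submodule.subset_span hm, ?_⟩
    convert! hsum using 2 with n
    rw [oddCount_add n hfg (hX k hk), oddCount_add n hf hg]
    simp only [b, c, Fintype.card_sum, Fintype.card_fin]
    push_cast
    ring
  have c_zero : ∀ k, k ≠ 0 → c k 0 = 1 := fun k hk => oddCount_zero (hX k hk)
  have b_zero : b 0 = 1 := by simp [b, oddCount_zero hf, oddCount_zero hg]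
  obtain ⟨m₃, hm₃, hs₃⟩ := hmult 3 (by norm_num)
  obtain ⟨m₅, hm₅, hs₅⟩ := hmult 5 (by norm_num)
  have rat_mul : ∀ (r : ℚ) {x : ℝ}, x ∈ hkSpan F → (r : ℝ) * x ∈ hkSpan F := by
    intro r x hx
    rw [← Rat.smul_def]
    exact (hkSpan F).smul_mem r hx
  have rat_mem : ∀ r : ℚ, (r : ℝ) ∈ hkSpan F := fun r => by
    simpa using rat_mul r one_mem_hkSpan
  have c_three : ∀ n, c 3 (n + 1) = 2 := oddCount_X_pow_three
  have c_five_odd : ∀ n, c 5 (2 * n + 1) = 2 := fun n => (oddCount_X_pow_five n).1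
  have c_five_even : ∀ n, c 5 (2 * n + 2) = 4 := fun n => (oddCount_X_pow_five n).2
  constructor
  · have h := ((hs₃.sub (hs₅.mul_left (1 / 2))).sub
      (hasSum_ite_eq (0 : ℕ) (1 / 2 : ℝ))).mul_left (2 ^ 8)
    have h' := (Function.Injective.hasSum_iff (g := fun n : ℕ => 2 * n + 1)
      (fun a b h => by simpa using h) ?_).2 h
    · refine ⟨2 ^ 8 * (m₃ - 1 / 2 * m₅ - 1 / 2), ?_, ?_⟩
      · have := rat_mul (2 ^ 8) ((hkSpan F).sub_mem ((hkSpan F).sub_mem hm₃ (rat_mul (1 / 2) hm₅))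
          (rat_mem (1 / 2)))
        push_cast at this
        exact this
      · convert! h' using 2 with n
        simp only [Function.comp_apply, c_three, c_five_odd, b, Nat.add_eq_zero_iff, one_ne_zero,
          and_false, if_false]
        rw [show 8 * (2 * n + 1) = 16 * n + 8 by ring, pow_add]
        push_cast
        field_simp
        ring
    · intro n hn
      obtain _ | n := n
      · simp only [c_zero 3 (by norm_num), c_zero 5 (by norm_num), b_zero, if_true]
        norm_num
      · rcases Nat.even_or_odd' n with ⟨k, rfl | rfl⟩
        · exact absurd ⟨k, rfl⟩ hn
        · simp only [c_three, c_five_even, Nat.add_eq_zero_iff, one_ne_zero, and_false, if_false]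
          push_cast
          ring
  · have h := (hs₅.sub hs₃).mul_left (2 ^ 15)
    have h' := (Function.Injective.hasSum_iff (g := fun n : ℕ => 2 * n + 2)
      (fun a b h => by simpa using h) ?_).2 h
    · refine ⟨2 ^ 15 * (m₅ - m₃), ?_, ?_⟩
      · have := rat_mul (2 ^ 15) ((hkSpan F).sub_mem hm₅ hm₃)
        push_cast at this
        exact this
      · convert! h' using 2 with n
        simp only [Function.comp_apply, c_three, c_five_even, b]
        rw [show 8 * (2 * n + 2) = 16 * n + 16 by ring, pow_add]
        push_cast
        field_simp
        ring
    · intro n hn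
      obtain _ | n := n
      · simp only [c_zero 3 (by norm_num), c_zero 5 (by norm_num), sub_self, mul_zero]
      · rcases Nat.even_or_odd' n with ⟨k, rfl | rfl⟩
        · simp only [c_three, c_five_odd, sub_self, mul_zero]
        · exact absurd ⟨k, rfl⟩ hn

theorem hilbertKunz_of_constantCoeff_ne_zero {σ : Type*} {G : MvPowerSeries σ F}
    (hG : constantCoeff G ≠ 0) (n : ℕ) : hilbertKunz G n = 0 := by
  have hunit : IsUnit G := (MvPowerSeries.isUnit_iff_constantCoeff).2 hG.isUnit
  have htop : hkIdeal G n = ⊤ := by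
    rw [hkIdeal, Ideal.span_singleton_eq_top.2 hunit, sup_top_eq]
  have : Subsingleton (MvPowerSeries σ F ⧸ hkIdeal G n) :=
    Ideal.Quotient.subsingleton_iff.2 htop
  exact Module.finrank_zero_of_subsingleton

theorem coeff_zero_hkTheta {r : ℕ} (f : MvPowerSeries (Fin r) F) :
    PowerSeries.coeff 0 (hkTheta f) = hilbertKunz (uvSum f) 0 := by
  simp [hkTheta, uvSum, addUV]

theorem coeff_succ_hkTheta {r : ℕ} (f : MvPowerSeries (Fin r) F) (n : ℕ) :
    PowerSeries.coeff (n + 1) (hkTheta f) =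
      hilbertKunz (uvSum f) (n + 1) - 2 ^ (r + 1) * hilbertKunz (uvSum f) n := by
  rw [hkTheta, sub_mul, one_mul, map_sub, mul_assoc, PowerSeries.coeff_C_mul,
    PowerSeries.coeff_succ_X_mul, PowerSeries.coeff_mk, PowerSeries.coeff_mk]
  rfl

theorem coeff_hkTheta_eq_oddCount [CharP F 2] {r : ℕ} {f : MvPowerSeries (Fin r) F}
    (hf : constantCoeff f = 0) (n : ℕ) : PowerSeries.coeff n (hkTheta f) = oddCount f n := by
  obtain _ | n := n
  · rw [coeff_zero_hkTheta, hilbertKunz_uvSum_zero hf]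
  · rw [coeff_succ_hkTheta, hilbertKunz_uvSum_succ n hf, Fintype.card_fin]
    ring

theorem coeff_hkTheta_eq_zero {r : ℕ} {f : MvPowerSeries (Fin r) F} (hf : constantCoeff f ≠ 0)
    (n : ℕ) : PowerSeries.coeff n (hkTheta f) = 0 := by
  have h : constantCoeff (uvSum f) ≠ 0 := by rwa [constantCoeff_uvSum]
  obtain _ | n := n
  · simp [coeff_zero_hkTheta, hilbertKunz_of_constantCoeff_ne_zero h]
  · simp [coeff_succ_hkTheta, hilbertKunz_of_constantCoeff_ne_zero h]

end main

theorem theorem1p10 {F : Type*} [Field F] [CharP F 2] (f : MvPowerSeries (Fin 3) F)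
    (a : ℕ → ℤ) (ha : hkTheta f = PowerSeries.mk a) :
    (∃ S ∈ hkSpan F, HasSum (fun n : ℕ => (a (2 * n) : ℝ) ^ 2 / 2 ^ (16 * n)) S) ∧
    (∃ S ∈ hkSpan F, HasSum (fun n : ℕ => (a (2 * n + 1) : ℝ) ^ 2 / 2 ^ (16 * n)) S) ∧
    (∃ S ∈ hkSpan F,
      HasSum (fun n : ℕ => (a (2 * n) : ℝ) * (a (2 * n + 1) : ℝ) / 2 ^ (16 * n)) S) ∧
    (∃ S ∈ hkSpan F,
      HasSum (fun n : ℕ => (a (2 * n + 1) : ℝ) * (a (2 * n + 2) : ℝ) / 2 ^ (16 * n)) S) ∧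
    (∃ S ∈ hkSpan F,
      HasSum (fun n : ℕ => (a (2 * n) : ℝ) * (a (2 * n + 2) : ℝ) / 2 ^ (16 * n)) S) := by
  have hcoeff : ∀ n, a n = PowerSeries.coeff n (hkTheta f) := fun n => by
    rw [ha, PowerSeries.coeff_mk]
  by_cases hf : MvPowerSeries.constantCoeff f = 0
  swap
  -- Here `uv + f` is a unit, so all its `e_n` are zero.
  · have h0 : ∀ n, a n = 0 := fun n => by rw [hcoeff, coeff_hkTheta_eq_zero hf]
    simp only [h0, Int.cast_zero, mul_zero, zero_pow two_ne_zero, zero_div]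
    have h : ∃ S ∈ hkSpan F, HasSum (fun _ : ℕ => (0 : ℝ)) S :=
      ⟨0, (hkSpan F).zero_mem, hasSum_zero⟩
    exact ⟨h, h, h, h, h⟩
  have ha' : ∀ n, a n = oddCount f n := fun n => by rw [hcoeff, coeff_hkTheta_eq_oddCount hf]
  have hf2 : MvPowerSeries.constantCoeff (f ^ 2) = 0 := by simp [hf]
  have hf4 : MvPowerSeries.constantCoeff ((f ^ 2) ^ 2) = 0 := by simp [hf]
  have hsq : ∀ n, (oddCount (f ^ 2) (n + 1) : ℝ) = 8 * oddCount f n := fun n => by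
    rw [oddCount_sq_succ n hf]
    norm_num
  have hsq2 : ∀ n, (oddCount ((f ^ 2) ^ 2) (n + 2) : ℝ) = 64 * oddCount f n := fun n => by
    rw [oddCount_sq_succ (n + 1) hf2]
    push_cast
    rw [hsq]
    norm_num
    ring
  have scale : ∀ (r : ℚ) {u v : ℕ → ℝ}, (∃ S ∈ hkSpan F, HasSum u S) → (∀ n, v n = r * u n) →
      ∃ S ∈ hkSpan F, HasSum v S := by
    rintro r u v ⟨S, hS, hu⟩ huv
    refine ⟨r * S, ?_, ?_⟩
    · rw [← Rat.smul_def]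
      exact (hkSpan F).smul_mem r hS
    · rw [funext huv]
      exact hu.mul_left _
  simp only [ha']
  obtain ⟨h0odd, S, hS, h0even⟩ := exists_hasSum_oddCount_mul hf hf
  obtain ⟨h1odd, h1even⟩ := exists_hasSum_oddCount_mul hf hf2
  obtain ⟨-, h2even⟩ := exists_hasSum_oddCount_mul hf hf4
  -- The first series has the extra term `a_0 ^ 2 = 1` before the sum over positive even indices.
  -- The scalars `1 / 8` and `1 / 64` undo the factors from replacing one `f` by `f ^ 2` or `f ^ 4`.
  refine ⟨⟨1 + (2 ^ 16)⁻¹ * S, ?_, ?_⟩, scale 1 h0odd fun n => ?_, scale (1 / 8) h1odd fun n => ?_,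
    scale (1 / 8) h1even fun n => ?_, scale (1 / 64) h2even fun n => ?_⟩
  · have := (hkSpan F).add_mem one_mem_hkSpan ((hkSpan F).smul_mem (2 ^ 16 : ℚ)⁻¹ hS)
    rw [Rat.smul_def] at this
    push_cast at this
    exact this
  · rw [← hasSum_nat_add_iff' 1, Finset.sum_range_one, mul_zero, mul_zero, oddCount_zero hf,
      Int.cast_one, one_pow, pow_zero, div_one, add_sub_cancel_left]
    convert! h0even.mul_left ((2 ^ 16 : ℝ)⁻¹) using 2 with n
    rw [show 2 * (n + 1) = 2 * n + 2 by ring, mul_add, pow_add]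
    field_simp
  · push_cast
    ring
  · rw [hsq]
    push_cast
    ring
  · rw [hsq]
    push_cast
    ring
  · rw [hsq2]
    push_cast
    ring
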